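/- **Conventions.** Strings are elements of $\{0,1\}^*$, $\lambda$ is the empty string, and $\mathtt{halt}$ is a fixed nonempty string. An *interactive algorithm* is a randomized map $(s',a)=\mathcal M(s,q;r)$ from a state $s$ and a message $q$ to a new state $s'\ne\lambda$ and an answer $a\neq\lambda$ (all strings), measurable in its coins $r$, an infinite sequence of fair bits that is fresh in every call; a computation is allowed not to terminate. It is *deterministic* if it does not depend on $r$. In the *interaction* $\mathcal A\leftrightarrow\mathcal M(x)$ one starts with $s^{\mathcal M}=x$, $s^{\mathcal A}=\lambda$, $m_0=\lambda$; in odd rounds $i$, $(s^{\mathcal M},m_i)\gets\mathcal M(s^{\mathcal M},m_{i-1})$, in even rounds $i\geq 2$, $(s^{\mathcal A},m_i)\gets\mathcal A(s^{\mathcal A},m_{i-1};r_i)$; the interaction ends once $m_i=\mathtt{halt}$, or when a computation does not terminate. The *view* of $\mathcal A$ is the finite or infinite sequence $\mathrm{View}(\mathcal A\leftrightarrow\mathcal M(x))=(r_0,m_1,r_2,m_3,\dots)$ of the coins of $\mathcal A$ and of the messages it receives. A *generalized probability distance* $(\mathcal D,\preceq,D)$ consists of a poset $(\mathcal D,\preceq)$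 and a map $D$ that takes any two probability laws on the same measurable space (written as random variables with these laws) to an element of $\mathcal D$, such that (i) $D(g(X),g(X'))\preceq D(X,X')$ for every measurable $g$, and (ii) if $D(X_i,X'_i)\preceq d$ for all $i\in\mathcal I$, where the laws of $X_i$ and of $X_i'$ depend measurably on $i$, and $I$ is a random index in $\mathcal I$, then $D(X_I,X'_I)\preceq d$. Fix one, an element $d\in\mathcal D$, a set $\mathcal X\subseteq\{0,1\}^*$ of datasets and a binary relation "neighboring" on $\{0,1\}^*$. An interactive mechanism (interactive algorithm taking a dataset as its initial state) $\mathcal M$ is *$d$-$\mathcal D$ DP on $\mathcal X$* if $D(\mathrm{View}(\mathcal A\leftrightarrow\mathcal M(x)),\mathrm{View}(\mathcal A\leftrightarrow\mathcal M(x')))\preceq d$ for every interactive algorithm $\mathcal A$ and all neighboring $x,x'\in\mathcal X$. A *person-in-the-middle (PIM) mechanism* is a randomized map $(s',v',m')=\mathcal P(s,v,m)$ with $s,m,s',m'\in\{0,1\}^*$, $v,v'\in\{Q,A\}$ and $m'\neq\lambda$ (possibly non-terminating, measurable in its coins). The *postprocessing* $\mathcal P\circ\mathcal M$ is the following interactive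 mechanism. On state $s$ and message $m$: if $m=\lambda$, set $s^{\mathcal M}\gets s$, $s^{\mathcal P}\gets\lambda$, $v\gets Q$; otherwise parse $s=(s^{\mathcal M},s^{\mathcal P})$ and let $(s^{\mathcal P},v,m)\gets\mathcal P(s^{\mathcal P},Q,m)$. While $v=Q$, let $(s^{\mathcal M},m)\gets\mathcal M(s^{\mathcal M},m)$ and then $(s^{\mathcal P},v,m)\gets\mathcal P(s^{\mathcal P},A,m)$. When $v=A$, return $((s^{\mathcal M},s^{\mathcal P}),m)$. All calls use independent coins; if the loop runs forever, the computation does not terminate. As in any interaction, a message $\mathtt{halt}$ between $\mathcal P$ and $\mathcal M$, in either direction, ends their interaction: from then on $\mathcal M$ is not run any more and the message $\mathtt{halt}$ takes the place of its answers. **Theorem.** If $\mathcal P$ is a PIM mechanism and $\mathcal M$ is an interactive mechanism that is $d$-$\mathcal D$ DP on $\mathcal X$, then $\mathcal P\circ\mathcal M$ is $d$-$\mathcal D$ DP on $\mathcal X$. **Corollary.** Let $\mathcal N$ be an interactive mechanism such that for all neighboring datasets $x,x'\in\mathcal X$ and every deterministic adversary $\mathcal A$ there are an interactive mechanism $\mathcal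 M$ that is $d$-$\mathcal D$ DP on the dataset universe $\{x,x'\}$ and a PIM mechanism $\mathcal P$ such that $\mathrm{View}(\mathcal A\leftrightarrow\mathcal N(x))$ and $\mathrm{View}(\mathcal A\leftrightarrow\mathcal P\circ\mathcal M(x))$ have the same law, and likewise for $x'$. Then $\mathcal N$ is $d$-$\mathcal D$ DP on $\mathcal X$. -/

import Mathlib

open MeasureTheory ProbabilityTheory

/-! ### Strings, messages and coins -/

/-- Binary strings `{0,1}*`; the empty string `λ` is `[]`. -/
abbrev Str := List Bool

instance instMeasurableSpaceStr : MeasurableSpace Str := ⊤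

/-- The message `halt`, a fixed nonempty string (which one is immaterial). -/
def haltMsg : Str := [true]

/-- The random coins available to a machine in one step: an infinite sequence of bits. -/
abbrev Coins := ℕ → Bool

/-- A fair coin toss. -/
noncomputable def fairBit : Measure Bool := (PMF.uniformOfFintype Bool).toMeasure

instance instIsProbabilityMeasureFairBit : IsProbabilityMeasure fairBit := by
  unfold fairBit; infer_instance

/-- Independent fair coin tosses. -/
noncomputable def coinLaw : Measure Coins := Measure.infinitePi fun _ => fairBit

instance instIsProbabilityMeasureCoinLaw : IsProbabilityMeasure coinLaw := by
  unfold coinLaw; infer_instance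

/-- The `k`-th of countably many disjoint streams of coins contained in one sequence of coins. -/
def stream (r : Coins) (k : ℕ) : Coins := fun j => r (Nat.pair k j)

/-- The fibres of `f` are measurable. For maps into a countable set this is measurability with
respect to the discrete σ-algebra on that set. -/
def FiberMeasurable {Ω α : Type} [MeasurableSpace Ω] (f : Ω → α) : Prop :=
  ∀ a, MeasurableSet {ω | f ω = a}

/-! ### Interactive algorithms -/

/-- An interactive algorithm (randomized state machine): `step s q r = some (s', a)` means that
in state `s`, on message `q` and with coins `r`, it moves to state `s'` and answers `a`;
`step s q r = none` means that this computation does not terminate. New states and answers are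
never the empty string. -/
structure InteractiveAlgorithm where
  step : Str → Str → Coins → Option (Str × Str)
  measurable_step : ∀ s q, FiberMeasurable (step s q)
  nonempty_output : ∀ s q r s' a, step s q r = some (s', a) → s' ≠ [] ∧ a ≠ []

/-- The algorithm does not use its coins. -/
def InteractiveAlgorithm.IsDeterministic (A : InteractiveAlgorithm) : Prop :=
  ∀ s q r r', A.step s q r = A.step s q r'

/-- The interaction of the adversary `A` with the mechanism `M` on input `x`, where `ω i` are the
coins tossed in round `i`. The value at `i` is `some (s^M_{i+1}, s^A_{i+1}, m_i)`, or `none` if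
the interaction ended before round `i` or a computation in a round `≤ i` does not terminate.
`M` moves in odd rounds, `A` moves in even rounds, and the message `halt` ends the interaction. -/
def interaction (A M : InteractiveAlgorithm) (x : Str) (ω : ℕ → Coins) :
    ℕ → Option (Str × Str × Str)
  | 0 => some (x, [], [])
  | i + 1 => (interaction A M x ω i).bind fun c =>
      if c.2.2 = haltMsg then none
      else if Odd (i + 1) then
        (M.step c.1 c.2.2 (ω (i + 1))).map fun o => (o.1, c.2.1, o.2)
      else
        (A.step c.2.1 c.2.2 (ω (i + 1))).map fun o => (c.1, o.1, o.2)

/-- One entry of a view: coins (`Sum.inl r`), a message (`Sum.inr (Sum.inl m)`), or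
`Sum.inr (Sum.inr ())` if the view contains no entry at this place. -/
abbrev ViewEntry := Coins ⊕ (Str ⊕ Unit)

/-- Views `(r_0, m_1, r_2, m_3, r_4, …)`. -/
abbrev View := ℕ → ViewEntry

/-- The adversary's view: at odd `i` the message `m_i` that it receives, at even `i` the coins
`r_i` that it tosses. The view ends where the interaction ends. -/
def view (A M : InteractiveAlgorithm) (x : Str) (ω : ℕ → Coins) : View
  | 0 => Sum.inl (ω 0)
  | i + 1 =>
      if Odd (i + 1) then
        match interaction A M x ω (i + 1) with
        | some c => Sum.inr (Sum.inl c.2.2)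
        | none => Sum.inr (Sum.inr ())
      else
        match interaction A M x ω i with
        | some c => if c.2.2 = haltMsg then Sum.inr (Sum.inr ()) else Sum.inl (ω (i + 1))
        | none => Sum.inr (Sum.inr ())

/-! ### Measurability of views -/

theorem FiberMeasurable.comp {Ω Ω' α : Type} [MeasurableSpace Ω] [MeasurableSpace Ω']
    {f : Ω' → α} (hf : FiberMeasurable f) {g : Ω → Ω'} (hg : Measurable g) :
    FiberMeasurable fun ω => f (g ω) := fun a => hg (hf a)

theorem FiberMeasurable.const {Ω α : Type} [MeasurableSpace Ω] (b : α) :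
    FiberMeasurable fun _ : Ω => b := fun a => by
  by_cases h : b = a <;> simp [h]

theorem FiberMeasurable.bind {Ω α β : Type} [MeasurableSpace Ω] [Countable α]
    {f : Ω → α} (hf : FiberMeasurable f) {g : α → Ω → β} (hg : ∀ a, FiberMeasurable (g a)) :
    FiberMeasurable fun ω => g (f ω) ω := fun b => by
  have : {ω | g (f ω) ω = b} = ⋃ a, {ω | f ω = a} ∩ {ω | g a ω = b} := by
    ext ω; simp
  rw [this]
  exact MeasurableSet.iUnion fun a => (hf a).inter (hg a b)

theorem FiberMeasurable.map {Ω α β : Type} [MeasurableSpace Ω] [Countable α]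
    {f : Ω → α} (hf : FiberMeasurable f) (g : α → β) : FiberMeasurable fun ω => g (f ω) :=
  hf.bind (g := fun a _ => g a) fun a => FiberMeasurable.const (g a)

theorem FiberMeasurable.optionBind {Ω α β : Type} [MeasurableSpace Ω] [Countable α]
    {f : Ω → Option α} (hf : FiberMeasurable f) {g : α → Ω → Option β}
    (hg : ∀ a, FiberMeasurable (g a)) :
    FiberMeasurable fun ω => (f ω).bind fun a => g a ω :=
  hf.bind (g := fun o ω => o.bind fun a => g a ω) fun o => by
    cases o with
    | none => exact FiberMeasurable.const none
    | some a => exact hg a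

theorem FiberMeasurable.measurable_bind {Ω α β : Type} [MeasurableSpace Ω] [MeasurableSpace β]
    [Countable α] {f : Ω → α} (hf : FiberMeasurable f) {g : α → Ω → β}
    (hg : ∀ a, Measurable (g a)) : Measurable fun ω => g (f ω) ω := fun s hs => by
  have : (fun ω => g (f ω) ω) ⁻¹' s = ⋃ a, {ω | f ω = a} ∩ g a ⁻¹' s := by
    ext ω; simp
  rw [this]
  exact MeasurableSet.iUnion fun a => (hf a).inter (hg a hs)

theorem fiberMeasurable_interaction (A M : InteractiveAlgorithm) (x : Str) (i : ℕ) :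
    FiberMeasurable fun ω => interaction A M x ω i := by
  induction i with
  | zero => exact FiberMeasurable.const _
  | succ i ih =>
    refine ih.optionBind fun c => ?_
    by_cases h : c.2.2 = haltMsg
    · simpa only [h, if_true] using FiberMeasurable.const none
    by_cases h' : Odd (i + 1)
    · simp only [h, h', if_true, if_false]
      exact ((M.measurable_step c.1 c.2.2).comp (measurable_pi_apply (i + 1))).map
        (Option.map fun o => (o.1, c.2.1, o.2))
    · simp only [h, h', if_false]
      exact ((A.measurable_step c.2.1 c.2.2).comp (measurable_pi_apply (i + 1))).map
        (Option.map fun o => (c.1, o.1, o.2))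

theorem measurable_view (A M : InteractiveAlgorithm) (x : Str) : Measurable (view A M x) := by
  refine measurable_pi_lambda _ fun i => ?_
  cases i with
  | zero => exact measurable_inl.comp (measurable_pi_apply 0)
  | succ i =>
    by_cases h' : Odd (i + 1)
    · simp only [view, h', if_true]
      refine (fiberMeasurable_interaction A M x (i + 1)).measurable_bind
        (g := fun o _ => (match o with
          | some c => Sum.inr (Sum.inl c.2.2)
          | none => Sum.inr (Sum.inr ()) : ViewEntry)) fun o => ?_
      cases o <;> exact measurable_const
    · simp only [view, h', if_false]
      refine (fiberMeasurable_interaction A M x i).measurable_bind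
        (g := fun o ω => (match o with
          | some c => if c.2.2 = haltMsg then Sum.inr (Sum.inr ()) else Sum.inl (ω (i + 1))
          | none => Sum.inr (Sum.inr ()) : ViewEntry)) fun o => ?_
      cases o with
      | none => exact measurable_const
      | some c =>
        by_cases h : c.2.2 = haltMsg
        · simp only [h, if_true]; exact measurable_const
        · simp only [h, if_false]
          exact measurable_inl.comp (measurable_pi_apply (i + 1))

/-- The law of `View(A ↔ M(x))`, all coins being fair and independent. -/
noncomputable def viewLaw (A M : InteractiveAlgorithm) (x : Str) : ProbabilityMeasure View :=
  ⟨(Measure.infinitePi fun _ : ℕ => coinLaw).map (view A M x),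
    Measure.isProbabilityMeasure_map (measurable_view A M x).aemeasurable⟩

/-! ### Generalized probability distances and privacy -/

/-- A generalized probability distance with values in a poset `𝒟`. A pair of random variables
over the same measurable space enters through its pair of laws. In `jointConvexity`, the random
index has law `I` and, given that it equals `i`, the two variables have the laws `κ i` and
`κ' i`. -/
structure GeneralizedProbabilityDistance (𝒟 : Type*) [PartialOrder 𝒟] where
  dist : ∀ {Ω : Type} [MeasurableSpace Ω], ProbabilityMeasure Ω → ProbabilityMeasure Ω → 𝒟
  postprocessing : ∀ {Ω Ω' : Type} [MeasurableSpace Ω] [MeasurableSpace Ω'] (g : Ω → Ω')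
    (hg : Measurable g) (μ ν : ProbabilityMeasure Ω),
    dist (μ.map hg.aemeasurable) (ν.map hg.aemeasurable) ≤ dist μ ν
  jointConvexity : ∀ {ι Ω : Type} [MeasurableSpace ι] [MeasurableSpace Ω]
    (I : ProbabilityMeasure ι) (κ κ' : Kernel ι Ω) [IsMarkovKernel κ] [IsMarkovKernel κ'] (d : 𝒟),
    (∀ i, dist ⟨κ i, inferInstance⟩ ⟨κ' i, inferInstance⟩ ≤ d) →
    dist ⟨(I : Measure ι).bind κ, inferInstance⟩ ⟨(I : Measure ι).bind κ', inferInstance⟩ ≤ d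

/-- `M` is `d`-`𝒟` DP on the dataset universe `X` with neighboring relation `adj`. -/
def IsDP {𝒟 : Type*} [PartialOrder 𝒟] (D : GeneralizedProbabilityDistance 𝒟) (X : Set Str)
    (adj : Str → Str → Prop) (d : 𝒟) (M : InteractiveAlgorithm) : Prop :=
  ∀ A : InteractiveAlgorithm, ∀ x ∈ X, ∀ x' ∈ X, adj x x' →
    D.dist (viewLaw A M x) (viewLaw A M x') ≤ d

/-! ### Person-in-the-middle mechanisms -/

/-- The tag `Q` (query) or `A` (answer) of a message received or sent by a person in the
middle. -/
inductive Tag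
  | Q
  | A

instance instCountableTag : Countable Tag :=
  Function.Injective.countable (f := fun v : Tag => match v with | .Q => true | .A => false)
    (by intro v w; cases v <;> cases w <;> simp)

/-- A person-in-the-middle mechanism, `(s', v', m') = P(s, v, m; r)`. It never sends the empty
message; `none` means that a computation does not terminate. -/
structure PIM where
  step : Str → Tag → Str → Coins → Option (Str × Tag × Str)
  measurable_step : ∀ s v m, FiberMeasurable (step s v m)
  nonempty_message : ∀ s v m r s' v' m', step s v m r = some (s', v', m') → m' ≠ []

/-- Encoding of the pair of states `(s^M, s^P)` as a string; `none` in place of `s^M` records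
that the interaction of `P` with `M` is over. -/
def packState : Option Str → Str → Str
  | none, b => false :: b
  | some a, b => true :: (a.flatMap (fun c => [true, c]) ++ false :: b)

/-- Splits an encoded pair of strings. -/
def splitPair : Str → Str × Str
  | true :: c :: l => (c :: (splitPair l).1, (splitPair l).2)
  | false :: l => ([], l)
  | _ => ([], [])

/-- Decoding of pairs of states. -/
def unpackState : Str → Option Str × Str
  | false :: b => (none, b)
  | true :: l => (some (splitPair l).1, (splitPair l).2)
  | [] => (none, [])

theorem unpackState_packState (a : Option Str) (b : Str) :
    unpackState (packState a b) = (a, b) := by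
  cases a with
  | none => rfl
  | some a =>
    have h : splitPair (a.flatMap (fun c => [true, c]) ++ false :: b) = (a, b) := by
      induction a with
      | nil => simp [splitPair]
      | cons c a ih => simp only [List.flatMap_cons, List.cons_append, List.nil_append,
          splitPair, ih]
    simp [packState, unpackState, h]

theorem packState_ne_nil (a : Option Str) (b : Str) : packState a b ≠ [] := by
  cases a <;> simp [packState]

/-- `P` sends the query `q` to `M`. The state of `M` is `none` if the interaction between `P`
and `M` is over. As in every interaction, the message `halt`, sent by either side, ends it: `M` is
not run any more, and from then on `P` gets the answer `halt`. -/
def callMechanism (M : InteractiveAlgorithm) :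
    Option Str → Str → Coins → Option (Option Str × Str)
  | none, _, _ => some (none, haltMsg)
  | some s, q, r =>
      if q = haltMsg then some (none, haltMsg)
      else (M.step s q r).map fun o => (if o.2 = haltMsg then none else some o.1, o.2)

/-- The variables `(s^M, s^P, v, m)` of the loop of `P ∘ M`. -/
abbrev LoopState := Option Str × Str × Tag × Str

/-- The variables on entry into the loop, when `P ∘ M` in state `s` receives the message `m`. -/
def loopStart (P : PIM) (s m : Str) (r : Coins) : Option LoopState :=
  if m = [] then some (some s, [], Tag.Q, [])
  else (P.step (unpackState s).2 Tag.Q m (stream r 0)).map fun o => ((unpackState s).1, o)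

/-- One pass through the body of the loop, if `v = Q`; the two machines use fresh coins `r₁` and
`r₂`. If `v = A`, nothing changes. -/
def loopBody (P : PIM) (M : InteractiveAlgorithm) (r₁ r₂ : Coins) : LoopState → Option LoopState
  | (sM, sP, Tag.A, m) => some (sM, sP, Tag.A, m)
  | (sM, sP, Tag.Q, m) => (callMechanism M sM m r₁).bind fun c =>
      (P.step sP Tag.A c.2 r₂).map fun o => (c.1, o)

/-- The variables after `k` passes through the loop. -/
def loopIter (P : PIM) (M : InteractiveAlgorithm) (s m : Str) (r : Coins) : ℕ → Option LoopState
  | 0 => loopStart P s m r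
  | k + 1 => (loopIter P M s m r k).bind
      (loopBody P M (stream r (2 * k + 1)) (stream r (2 * k + 2)))

/-- What `P ∘ M` returns if the loop is left with the given variables (`none` if `v = Q`, so that
the loop is not left). -/
def loopOutput : LoopState → Option (Str × Str)
  | (sM, sP, Tag.A, m) => some (packState sM sP, m)
  | (_, _, Tag.Q, _) => none

open Classical in
/-- One step of `P ∘ M`: run the loop until `v = A`; no value if this never happens. -/
noncomputable def compStep (P : PIM) (M : InteractiveAlgorithm) (s m : Str) (r : Coins) :
    Option (Str × Str) :=
  if h : ∃ k, ((loopIter P M s m r k).bind loopOutput).isSome then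
    (loopIter P M s m r (Nat.find h)).bind loopOutput
  else none

theorem measurable_stream (k : ℕ) : Measurable fun r : Coins => stream r k :=
  measurable_pi_lambda _ fun j => measurable_pi_apply (Nat.pair k j)

theorem fiberMeasurable_callMechanism (M : InteractiveAlgorithm) (t : Option Str) (q : Str) :
    FiberMeasurable (callMechanism M t q) := by
  cases t with
  | none => exact FiberMeasurable.const _
  | some s =>
    by_cases h : q = haltMsg
    · have : callMechanism M (some s) q = fun _ => some (none, haltMsg) := by
        funext r; simp [callMechanism, h]
      rw [this]; exact FiberMeasurable.const _
    · have : callMechanism M (some s) q = fun r => (M.step s q r).map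
          fun o => (if o.2 = haltMsg then none else some o.1, o.2) := by
        funext r; simp [callMechanism, h]
      rw [this]; exact (M.measurable_step s q).map _

theorem fiberMeasurable_loopIter (P : PIM) (M : InteractiveAlgorithm) (s m : Str) (k : ℕ) :
    FiberMeasurable fun r => loopIter P M s m r k := by
  induction k with
  | zero =>
    by_cases h : m = []
    · simp only [loopIter, loopStart, h, if_true]; exact FiberMeasurable.const _
    · simp only [loopIter, loopStart, h, if_false]
      exact ((P.measurable_step _ _ _).comp (measurable_stream 0)).map
        (Option.map fun o => ((unpackState s).1, o))
  | succ k ih =>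
    refine ih.optionBind (g := fun c r =>
      loopBody P M (stream r (2 * k + 1)) (stream r (2 * k + 2)) c) fun c => ?_
    obtain ⟨sM, sP, v, m'⟩ := c
    cases v with
    | A => exact FiberMeasurable.const _
    | Q =>
      refine ((fiberMeasurable_callMechanism M sM m').comp (measurable_stream _)).optionBind
        (g := fun c r => (P.step sP Tag.A c.2 (stream r (2 * k + 2))).map fun o => (c.1, o))
        fun c => ?_
      exact ((P.measurable_step _ _ _).comp (measurable_stream _)).map
        (Option.map fun o => (c.1, o))

theorem fiberMeasurable_compStep (P : PIM) (M : InteractiveAlgorithm) (s m : Str) :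
    FiberMeasurable (compStep P M s m) := by
  classical
  have hk : ∀ k, FiberMeasurable fun r => (loopIter P M s m r k).bind loopOutput := fun k =>
    (fiberMeasurable_loopIter P M s m k).map fun o => o.bind loopOutput
  intro y
  have hset : {r | compStep P M s m r = y} =
      (⋃ k, ({r | (loopIter P M s m r k).bind loopOutput = y} ∩
        {r | (loopIter P M s m r k).bind loopOutput = none}ᶜ) ∩
        ⋂ j : Fin k, {r | (loopIter P M s m r j).bind loopOutput = none}) ∪
      ((⋂ k, {r | (loopIter P M s m r k).bind loopOutput = none}) ∩ {_r | none = y}) := by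
    ext r
    simp only [Set.mem_union, Set.mem_iUnion, Set.mem_inter_iff, Set.mem_iInter,
      Set.mem_ofPred_eq, Set.mem_compl_iff]
    by_cases h : ∃ k, ((loopIter P M s m r k).bind loopOutput).isSome
    · have hc : compStep P M s m r = (loopIter P M s m r (Nat.find h)).bind loopOutput := by
        simp only [compStep]; rw [dif_pos h]
      rw [hc]
      constructor
      · intro hy
        refine Or.inl ⟨Nat.find h, ⟨hy, Option.ne_none_iff_isSome.2 (Nat.find_spec h)⟩,
          fun j => ?_⟩
        have := Nat.find_min h j.2
        simpa using this
      · rintro (⟨k, ⟨hy, hne⟩, hlt⟩ | ⟨hnone, -⟩)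
        · have : Nat.find h = k := by
            rw [Nat.find_eq_iff]
            refine ⟨Option.ne_none_iff_isSome.1 hne, fun j hj => ?_⟩
            rw [hlt ⟨j, hj⟩]; simp
          rw [this, hy]
        · obtain ⟨k, hk'⟩ := h
          rw [hnone k] at hk'; simp at hk'
    · have hc : compStep P M s m r = none := by
        simp only [compStep]; rw [dif_neg h]
      have hn : ∀ k, (loopIter P M s m r k).bind loopOutput = none := fun k => by
        by_contra hne
        exact h ⟨k, Option.ne_none_iff_isSome.1 hne⟩
      rw [hc]
      constructor
      · exact fun hy => Or.inr ⟨hn, hy⟩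
      · rintro (⟨k, ⟨-, hne⟩, -⟩ | ⟨-, hy⟩)
        · exact absurd (hn k) hne
        · exact hy
  rw [hset]
  exact (MeasurableSet.iUnion fun k => ((hk k y).inter (hk k none).compl).inter
    (MeasurableSet.iInter fun j : Fin k => hk j none)).union
    ((MeasurableSet.iInter fun k => hk k none).inter (MeasurableSet.const _))

/-- In every loop state reached, a message sent by `P` is nonempty. -/
theorem loopIter_message_ne (P : PIM) (M : InteractiveAlgorithm) (s m : Str) (r : Coins) (k : ℕ)
    (sM : Option Str) (sP m' : Str) (h : loopIter P M s m r k = some (sM, sP, Tag.A, m')) :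
    m' ≠ [] := by
  induction k generalizing sM sP m' with
  | zero =>
    by_cases hm : m = []
    · simp [loopIter, loopStart, hm] at h
    · simp only [loopIter, loopStart, hm, if_false, Option.map_eq_some_iff] at h
      obtain ⟨⟨a, b, c⟩, ho, heq⟩ := h
      simp only [Prod.mk.injEq] at heq
      obtain ⟨-, -, -, rfl⟩ := heq
      exact P.nonempty_message _ _ _ _ _ _ _ ho
  | succ k ih =>
    simp only [loopIter, Option.bind_eq_some_iff] at h
    obtain ⟨⟨tM, tP, v, n⟩, hc, hb⟩ := h
    cases v with
    | A =>
      simp only [loopBody, Option.some.injEq, Prod.mk.injEq] at hb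
      obtain ⟨-, -, -, rfl⟩ := hb
      exact ih _ _ _ hc
    | Q =>
      simp only [loopBody, Option.bind_eq_some_iff, Option.map_eq_some_iff] at hb
      obtain ⟨c, -, ⟨a, b, e⟩, ho, heq⟩ := hb
      simp only [Prod.mk.injEq] at heq
      obtain ⟨-, -, -, rfl⟩ := heq
      exact P.nonempty_message _ _ _ _ _ _ _ ho

/-- The postprocessing `P ∘ M` of the interactive mechanism `M` by the person-in-the-middle
mechanism `P`. -/
noncomputable def PIM.comp (P : PIM) (M : InteractiveAlgorithm) : InteractiveAlgorithm where
  step := compStep P M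
  measurable_step := fiberMeasurable_compStep P M
  nonempty_output := by
    classical
    intro s m r s' a h
    have key : ∃ k, (loopIter P M s m r k).bind loopOutput = some (s', a) := by
      unfold compStep at h
      split_ifs at h with hk
      exact ⟨_, h⟩
    obtain ⟨k, hk⟩ := key
    rw [Option.bind_eq_some_iff] at hk
    obtain ⟨⟨sM, sP, v, m'⟩, hi, ho⟩ := hk
    cases v with
    | Q => simp [loopOutput] at ho
    | A =>
      simp only [loopOutput, Option.some.injEq, Prod.mk.injEq] at ho
      obtain ⟨rfl, rfl⟩ := ho
      exact ⟨packState_ne_nil _ _, loopIter_message_ne P M s m r k _ _ _ hi⟩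

/-! An adversary `A` against `P ∘ M` can be absorbed into an adversary against `M` (the `emulator`)
that runs `P` and `A` internally and contacts `M` only when `P` does. What `A` receives is then a
function of the emulator's view, so postprocessing of `D` transfers the bound for `M`.

Randomized adversaries are removed beforehand (`dist_viewLaw_le`). Given the coins of `A`, its view
is a function of the messages received by the adversary with these coins hardwired; joint convexity
averages over the coins. The view of a deterministic adversary still lists idle coins, so the
argument works with the law of the received messages instead.

For deterministic `A`, both interactions are described by one chain of configurations with
transition map `Config.next`. They differ only in where each step finds its coins: in `P ∘ M`, a
round supplies coins for a whole run of the loop, while in the emulation it supplies either one call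
of `M` or everything that happens between two calls. As no coins are read twice, `map_chain_eq`
gives the two chains the same law. `messages_comp` recovers the messages from the outer chain.
`innerReached_innerChain` shows that the inner chain, up to the states of `M`, is a function
`replay` of the emulator's view.

Two situations need care. If `P` and `A` talk forever without calling `M`, the emulator does not
terminate, but the coins of that round are already in its view and `replay` continues with them. If
`halt` has ended the contact with `M`, the emulator gets no further coins, and the remaining steps
use spare streams of the coins of round `0`. -/

/-! ### Chains driven by independent coins -/

section Chain

variable {S J C : Type}

/-- The chain with transition map `f` that starts in `s₀` and in whose `n`-th step, from state
`s`, the coins with address `addr n s` in the table `τ` are used. -/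
def chain (f : S → C → S) (addr : ℕ → S → J) (s₀ : S) (τ : J → C) : ℕ → S
  | 0 => s₀
  | n + 1 => f (chain f addr s₀ τ n) (τ (addr n (chain f addr s₀ τ n)))

/-- Along every path that can be followed, no coins are used twice. -/
def FreshAddresses (f : S → C → S) (addr : ℕ → S → J) : Prop :=
  ∀ (s : ℕ → S) (n : ℕ), (∀ k < n, ∃ r, f (s k) r = s (k + 1)) →
    ∀ k < n, addr k (s k) ≠ addr n (s n)

/-- Once the path is prescribed, the addresses are no longer random: following `s` is a condition on
the coins at the fixed addresses `addr k (s k)`. -/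
theorem chain_eq_iff (f : S → C → S) (addr : ℕ → S → J) (s₀ : S) (τ : J → C) (s : ℕ → S) (n : ℕ) :
    (∀ k ≤ n, chain f addr s₀ τ k = s k) ↔
      s₀ = s 0 ∧ ∀ k < n, f (s k) (τ (addr k (s k))) = s (k + 1) := by
  induction n with
  | zero => simp [chain]
  | succ n ih =>
    constructor
    · intro h
      have h' := ih.1 fun k hk => h k (by omega)
      refine ⟨h'.1, fun k hk => ?_⟩
      rw [← h k (by omega), ← h (k + 1) (by omega)]
      rfl
    · rintro ⟨h0, h⟩ k hk
      have h' := ih.2 ⟨h0, fun k hk => h k (by omega)⟩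
      rcases Nat.lt_or_ge n k with hlt | hle
      · obtain rfl : k = n + 1 := by omega
        rw [← h n (by omega), ← h' n le_rfl]
        rfl
      · exact h' k hle

variable [MeasurableSpace C]

theorem fiberMeasurable_chain [Countable S] {f : S → C → S} (hf : ∀ s, FiberMeasurable (f s))
    (addr : ℕ → S → J) (s₀ : S) (n : ℕ) :
    FiberMeasurable fun τ : J → C => chain f addr s₀ τ n := by
  induction n with
  | zero => exact FiberMeasurable.const _
  | succ n ih =>
    exact ih.bind (g := fun s τ => f s (τ (addr n s))) fun s =>
      (hf s).comp (measurable_pi_apply _)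

theorem FiberMeasurable.measurable [Countable S] [MeasurableSpace S] {Ω : Type} [MeasurableSpace Ω]
    {g : Ω → S} (hg : FiberMeasurable g) : Measurable g :=
  hg.measurable_bind (g := fun s _ => s) fun _ => measurable_const

theorem Measurable.fiberMeasurable [MeasurableSpace S] [MeasurableSingletonClass S] {Ω : Type}
    [MeasurableSpace Ω] {g : Ω → S} (hg : Measurable g) : FiberMeasurable g :=
  fun s => hg (measurableSet_singleton s)

theorem measurable_chain [Countable S] [MeasurableSpace S] {f : S → C → S}
    (hf : ∀ s, FiberMeasurable (f s)) (addr : ℕ → S → J) (s₀ : S) :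
    Measurable (chain f addr s₀ : (J → C) → ℕ → S) :=
  measurable_pi_lambda _ fun n => (fiberMeasurable_chain hf addr s₀ n).measurable

/-- The right-hand side does not mention the addresses, which is the point. Freshness makes the
addresses along `s` distinct, so the coins read there are `n` independent samples of `ρ`. Freshness
says nothing about a path that cannot be followed, but then both events are empty. -/
theorem chain_cylinder {f : S → C → S} (hf : ∀ s, FiberMeasurable (f s)) {addr : ℕ → S → J}
    (hfresh : FreshAddresses f addr) (s₀ : S) (ρ : Measure C) [IsProbabilityMeasure ρ]
    (s : ℕ → S) (n : ℕ) :
    Measure.infinitePi (fun _ : J => ρ) {τ | ∀ k ≤ n, chain f addr s₀ τ k = s k} =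
      Measure.infinitePi (fun _ : Fin n => ρ)
        {t | s₀ = s 0 ∧ ∀ k : Fin n, f (s k) (t k) = s (k + 1)} := by
  by_cases hposs : ∀ k < n, ∃ r, f (s k) r = s (k + 1)
  · have hinj : Function.Injective fun k : Fin n => addr k (s k) := by
      have key : ∀ k l : Fin n, k < l → addr k (s k) ≠ addr l (s l) := fun k l hkl =>
        hfresh s l (fun i hi => hposs i (hi.trans l.2)) k hkl
      intro k l hkl
      rcases lt_trichotomy k l with h | h | h
      · exact absurd hkl (key _ _ h)
      · exact h
      · exact absurd hkl.symm (key _ _ h)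
    rw [← Measure.map_infinitePi_infinitePi_of_inj (P := fun _ : J => ρ) hinj,
      Measure.map_apply (measurable_pi_lambda _ fun k => measurable_pi_apply _)]
    · congr 1
      ext τ
      simp only [Set.mem_ofPred_eq, Set.mem_preimage, chain_eq_iff, Fin.forall_iff]
    · have : {t : Fin n → C | s₀ = s 0 ∧ ∀ k : Fin n, f (s k) (t k) = s (k + 1)} =
          {_t | s₀ = s 0} ∩ ⋂ k : Fin n, {t | f (s k) (t k) = s (k + 1)} := by
        ext t; simp
      rw [this]
      exact (MeasurableSet.const _).inter
        (MeasurableSet.iInter fun k => ((hf (s k)).comp (measurable_pi_apply k)) _)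
  · push Not at hposs
    obtain ⟨k, hk, hne⟩ := hposs
    have h1 : {τ : J → C | ∀ k ≤ n, chain f addr s₀ τ k = s k} = ∅ := by
      ext τ
      simp only [Set.mem_ofPred_eq, chain_eq_iff, Set.mem_empty_iff_false, iff_false]
      exact fun h => hne _ (h.2 k hk)
    have h2 : {t : Fin n → C | s₀ = s 0 ∧ ∀ k : Fin n, f (s k) (t k) = s (k + 1)} = ∅ := by
      ext t
      simp only [Set.mem_ofPred_eq, Set.mem_empty_iff_false, iff_false]
      exact fun h => hne _ (h.2 ⟨k, hk⟩)
    rw [h1, h2, measure_empty, measure_empty]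

/-- Initial segments are points of a countable space, so their probabilities determine the law of
each segment. Every finite set of indices lies in some segment, and the finite-dimensional marginals
determine the measure. -/
theorem Measure.ext_of_initial_segments [Countable S] [MeasurableSpace S]
    [MeasurableSingletonClass S] (μ ν : Measure (ℕ → S))
    [IsProbabilityMeasure μ] [IsProbabilityMeasure ν]
    (h : ∀ (s : ℕ → S) (n : ℕ), μ {y | ∀ k ≤ n, y k = s k} = ν {y | ∀ k ≤ n, y k = s k}) :
    μ = ν := by
  classical
  have hseg : ∀ n, μ.map (Preorder.frestrictLe n) =
      ν.map (Preorder.frestrictLe (π := fun _ => S) n) := by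
    intro n
    refine Measure.ext_of_singleton fun t => ?_
    rw [Measure.map_apply (by fun_prop) (measurableSet_singleton _),
      Measure.map_apply (by fun_prop) (measurableSet_singleton _)]
    have : Preorder.frestrictLe (π := fun _ => S) n ⁻¹' {t} = {y : ℕ → S | ∀ k ≤ n, y k =
        (fun k => if hk : k ≤ n then t ⟨k, Finset.mem_Iic.2 hk⟩
          else t ⟨n, Finset.mem_Iic.2 le_rfl⟩) k} := by
      ext y
      simp only [Set.mem_preimage, Set.mem_singleton_iff, Set.mem_ofPred_eq, funext_iff,
        Subtype.forall, Finset.mem_Iic]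
      refine forall₂_congr fun k hk => ?_
      simp [hk, Preorder.frestrictLe, Finset.restrict]
    rw [this]
    exact h _ n
  refine IsProjectiveLimit.unique (P := fun I : Finset ℕ => ν.map I.restrict) (fun I => ?_)
    (fun I => rfl)
  obtain ⟨n, hn⟩ : ∃ n, I ⊆ Finset.Iic n :=
    ⟨I.sup id, fun i hi => Finset.mem_Iic.2 (Finset.le_sup (f := id) hi)⟩
  have : (I.restrict : (ℕ → S) → _) =
      Finset.restrict₂ (π := fun _ => S) hn ∘ Preorder.frestrictLe n := rfl
  rw [this, ← Measure.map_map (by fun_prop) (by fun_prop), hseg,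
    Measure.map_map (by fun_prop) (by fun_prop), ← this]

/-- The law of a chain does not depend on where its coins come from, as long as they are fresh. -/
theorem map_chain_eq [Countable S] [MeasurableSpace S]
    [MeasurableSingletonClass S] {J' : Type} {f : S → C → S}
    (hf : ∀ s, FiberMeasurable (f s)) {addr : ℕ → S → J} (hfresh : FreshAddresses f addr)
    {addr' : ℕ → S → J'} (hfresh' : FreshAddresses f addr') (s₀ : S) (ρ : Measure C)
    [IsProbabilityMeasure ρ] :
    (Measure.infinitePi fun _ : J => ρ).map (chain f addr s₀) =
      (Measure.infinitePi fun _ : J' => ρ).map (chain f addr' s₀) := by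
  have := Measure.isProbabilityMeasure_map (μ := Measure.infinitePi fun _ : J => ρ)
    (measurable_chain hf addr s₀).aemeasurable
  have := Measure.isProbabilityMeasure_map (μ := Measure.infinitePi fun _ : J' => ρ)
    (measurable_chain hf addr' s₀).aemeasurable
  refine Measure.ext_of_initial_segments _ _ fun s n => ?_
  have hm : MeasurableSet {y : ℕ → S | ∀ k ≤ n, y k = s k} := by
    have : {y : ℕ → S | ∀ k ≤ n, y k = s k} = ⋂ k, ⋂ _ : k ≤ n, {y | y k = s k} := by
      ext y; simp
    rw [this]
    exact MeasurableSet.iInter fun k => MeasurableSet.iInter fun _ =>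
      Measurable.fiberMeasurable (g := fun y : ℕ → S => y k) (measurable_pi_apply k) (s k)
  rw [Measure.map_apply (measurable_chain hf addr s₀) hm,
    Measure.map_apply (measurable_chain hf addr' s₀) hm]
  exact (chain_cylinder hf hfresh s₀ ρ s n).trans (chain_cylinder hf hfresh' s₀ ρ s n).symm

end Chain

/-! ### Tables of coins -/

/-- Rearranging bits of independent coins, with no bit used twice, gives independent coins. -/
theorem map_coins_of_injective {J : Type} (e : J → ℕ → ℕ × ℕ)
    (he : Function.Injective fun p : J × ℕ => e p.1 p.2) :
    (Measure.infinitePi fun _ : ℕ => coinLaw).map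
      (fun (ω : ℕ → Coins) (a : J) (b : ℕ) => ω (e a b).1 (e a b).2) =
    Measure.infinitePi fun _ : J => coinLaw := by
  -- Both tables are uncurried into families of independent single bits, where the claim is
  -- reindexing along an injection.
  have h1 : (Measure.infinitePi fun _ : ℕ => coinLaw) =
      (Measure.infinitePi fun _ : ℕ × ℕ => fairBit).map (MeasurableEquiv.curry ℕ ℕ Bool) :=
    (Measure.infinitePi_map_curry (fun _ _ => fairBit)).symm
  have h2 : (Measure.infinitePi fun _ : J => coinLaw) =
      (Measure.infinitePi fun _ : J × ℕ => fairBit).map (MeasurableEquiv.curry J ℕ Bool) :=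
    (Measure.infinitePi_map_curry (fun _ _ => fairBit)).symm
  rw [h1, h2, ← Measure.map_infinitePi_infinitePi_of_inj (P := fun _ : ℕ × ℕ => fairBit) he,
    Measure.map_map (by fun_prop) (by fun_prop), Measure.map_map (by fun_prop) (by fun_prop)]
  rfl

/-- Coins from `ω` in even rounds and from `ω'` in odd rounds. -/
def mergeCoins (ω ω' : ℕ → Coins) (i : ℕ) : Coins := if Even i then ω i else ω' i

theorem measurable_mergeCoins :
    Measurable fun p : (ℕ → Coins) × (ℕ → Coins) => mergeCoins p.1 p.2 := by
  refine measurable_pi_lambda _ fun i => ?_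
  by_cases h : Even i <;> simp only [mergeCoins, h, if_true, if_false] <;> fun_prop

/-- The condition that a box imposes on the merged coins splits into one on even coordinates of the
first factor and one on odd coordinates of the second. -/
theorem map_mergeCoins (ρ : Measure Coins) [IsProbabilityMeasure ρ] :
    ((Measure.infinitePi fun _ : ℕ => ρ).prod (Measure.infinitePi fun _ : ℕ => ρ)).map
      (fun p => mergeCoins p.1 p.2) = Measure.infinitePi fun _ : ℕ => ρ := by
  classical
  refine Measure.eq_infinitePi _ fun s t ht => ?_
  rw [Measure.map_apply measurable_mergeCoins
    (MeasurableSet.pi s.countable_toSet fun i _ => ht i)]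
  have : (fun p : (ℕ → Coins) × (ℕ → Coins) => mergeCoins p.1 p.2) ⁻¹' (Set.pi s t) =
      Set.pi (s.filter Even) t ×ˢ Set.pi (s.filter fun i => ¬ Even i) t := by
    ext p
    simp only [Set.mem_preimage, Set.mem_pi, Set.mem_prod, Finset.coe_filter, Set.mem_ofPred_eq,
      Finset.mem_coe, mergeCoins]
    constructor
    · intro h
      exact ⟨fun i hi => by simpa [hi.2] using h i hi.1, fun i hi => by simpa [hi.2] using h i hi.1⟩
    · rintro ⟨h1, h2⟩ i hi
      by_cases he : Even i
      · simpa [he] using h1 i ⟨hi, he⟩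
      · simpa [he] using h2 i ⟨hi, he⟩
  rw [this, Measure.prod_prod, Measure.infinitePi_pi _ fun i _ => ht i,
    Measure.infinitePi_pi _ fun i _ => ht i, Finset.prod_filter_mul_prod_filter_not]

/-! ### First value of a sequence -/

open Classical in
/-- The first value of the sequence `g` that is not `none`. -/
noncomputable def firstSome {β : Type} (g : ℕ → Option β) : Option β :=
  if h : ∃ k, (g k).isSome then g (Nat.find h) else none

theorem firstSome_eq_some {β : Type} {g : ℕ → Option β} {b : β} (h : firstSome g = some b) :
    ∃ k, g k = some b := by
  unfold firstSome at h
  split_ifs at h with hk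
  exact ⟨_, h⟩

theorem firstSome_eq_of_forall {β : Type} {g : ℕ → Option β} {k : ℕ} {b : β} (hk : g k = some b)
    (h : ∀ j c, g j = some c → c = b) : firstSome g = some b := by
  have hex : ∃ k, (g k).isSome := ⟨k, by simp [hk]⟩
  unfold firstSome
  rw [dif_pos hex]
  obtain ⟨c, hc⟩ := Option.isSome_iff_exists.1 (Nat.find_spec hex)
  rw [hc, h _ _ hc]

theorem fiberMeasurable_firstSome {Ω β : Type} [MeasurableSpace Ω] {g : ℕ → Ω → Option β}
    (hg : ∀ k, FiberMeasurable (g k)) : FiberMeasurable fun ω => firstSome fun k => g k ω := by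
  classical
  have hnone : MeasurableSet {ω | ∀ k, g k ω = none} := by
    have : {ω | ∀ k, g k ω = none} = ⋂ k, {ω | g k ω = none} := by ext; simp
    rw [this]
    exact MeasurableSet.iInter fun k => hg k none
  intro y
  cases y with
  | none =>
    convert hnone using 1
    ext ω
    constructor
    · intro h k
      simp only [Set.mem_ofPred_eq, firstSome] at h
      split_ifs at h with hk
      · have := Nat.find_spec hk
        rw [h] at this
        simp at this
      · by_contra hne
        exact hk ⟨k, Option.ne_none_iff_isSome.1 hne⟩
    · intro h
      have h' : ∀ k, g k ω = none := h
      simp [firstSome, h']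
  | some b =>
    have : {ω | (firstSome fun k => g k ω) = some b} =
        ⋃ k, {ω | g k ω = some b} ∩ ⋂ j : Fin k, {ω | g j ω = none} := by
      ext ω
      simp only [Set.mem_iUnion, Set.mem_inter_iff, Set.mem_iInter, Set.mem_ofPred_eq]
      constructor
      · intro h
        unfold firstSome at h
        split_ifs at h with hk
        exact ⟨_, h, fun j => by simpa using Nat.find_min hk j.2⟩
      · rintro ⟨k, hk, hlt⟩
        have hex : ∃ k, (g k ω).isSome := ⟨k, by simp [hk]⟩
        have : Nat.find hex = k := by
          rw [Nat.find_eq_iff]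
          exact ⟨by simp [hk], fun j hj => by simp [hlt ⟨j, hj⟩]⟩
        unfold firstSome
        rw [dif_pos hex, this]
        exact hk
    rw [this]
    exact MeasurableSet.iUnion fun k => (hg k _).inter (MeasurableSet.iInter fun j => hg j none)

/-! ### Coding of states -/

/-- The elements of a countable type can be coded by nonempty strings. -/
theorem exists_coding {S : Type} [Countable S] (s₀ : S) :
    ∃ (enc : S → Str) (dec : Str → S),
      (∀ s, enc s ≠ []) ∧ (∀ s, dec (enc s) = s) ∧ dec [] = s₀ := by
  classical
  obtain ⟨e, he⟩ := exists_injective_nat S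
  -- Unary coding with one extra symbol keeps the empty string free, to be decoded as `s₀`.
  have hinj : Function.Injective fun s => List.replicate (e s + 1) true := fun s t h => by
    have := congrArg List.length h
    simp only [List.length_replicate, Nat.add_right_cancel_iff] at this
    exact he this
  have : Nonempty S := ⟨s₀⟩
  refine ⟨fun s => List.replicate (e s + 1) true,
    fun l => if l = [] then s₀ else Function.invFun (fun s => List.replicate (e s + 1) true) l,
    by simp, fun s => ?_, by simp⟩
  simp only [List.replicate_eq_nil_iff, Nat.add_eq_zero_iff, one_ne_zero, and_false, if_false]
  exact Function.leftInverse_invFun hinj s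

/-! ### Messages received by the adversary, and deterministic adversaries -/

/-- The `j`-th message that the adversary receives, if there is one. -/
def messages (A M : InteractiveAlgorithm) (x : Str) (ω : ℕ → Coins) (j : ℕ) : Option Str :=
  (interaction A M x ω (2 * j + 1)).map fun c => c.2.2

instance instMeasurableSpaceOptionStr : MeasurableSpace (Option Str) := ⊤

theorem measurable_messages (A M : InteractiveAlgorithm) (x : Str) :
    Measurable (messages A M x) :=
  measurable_pi_lambda _ fun j =>
    ((fiberMeasurable_interaction A M x (2 * j + 1)).map (Option.map fun c => c.2.2)).measurable

/-- The law of the messages that the adversary receives. -/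
noncomputable def messagesLaw (A M : InteractiveAlgorithm) (x : Str) :
    ProbabilityMeasure (ℕ → Option Str) :=
  ⟨(Measure.infinitePi fun _ : ℕ => coinLaw).map (messages A M x),
    Measure.isProbabilityMeasure_map (measurable_messages A M x).aemeasurable⟩

/-- The messages in a view. -/
def viewMessages (v : View) (j : ℕ) : Option Str :=
  match v (2 * j + 1) with
  | Sum.inr (Sum.inl m) => some m
  | _ => none

theorem measurable_viewMessages : Measurable viewMessages := by
  refine measurable_pi_lambda _ fun j => ?_
  have h : Measurable (Sum.elim (fun _ => none) (Sum.elim some fun _ => none) :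
      ViewEntry → Option Str) :=
    measurable_const.sumElim (Measurable.sumElim measurable_from_top measurable_const)
  have heq : (fun v : View => viewMessages v j) = fun v : View =>
      (Sum.elim (fun _ => none) (Sum.elim some fun _ => none) : ViewEntry → Option Str)
        (v (2 * j + 1)) := by
    funext v
    unfold viewMessages
    rcases v (2 * j + 1) with r | m | u <;> rfl
  rw [heq]
  exact h.comp (measurable_pi_apply _)

theorem viewMessages_view (A M : InteractiveAlgorithm) (x : Str) (ω : ℕ → Coins) :
    viewMessages (view A M x ω) = messages A M x ω := by
  funext j
  have h : Odd (2 * j + 1) := odd_two_mul_add_one j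
  simp only [viewMessages, messages, view, h, if_true]
  cases interaction A M x ω (2 * j + 1) <;> rfl

theorem map_viewLaw (A M : InteractiveAlgorithm) (x : Str) :
    (viewLaw A M x).map measurable_viewMessages.aemeasurable = messagesLaw A M x := by
  apply Subtype.ext
  change ((Measure.infinitePi fun _ : ℕ => coinLaw).map (view A M x)).map viewMessages =
    (Measure.infinitePi fun _ : ℕ => coinLaw).map (messages A M x)
  rw [Measure.map_map measurable_viewMessages (measurable_view A M x)]
  congr 1
  funext ω
  exact viewMessages_view A M x ω

/-- The view of an adversary with coins `c` that receives the messages `μ`. -/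
def assembleView (c : ℕ → Coins) (μ : ℕ → Option Str) : View
  | 0 => Sum.inl (c 0)
  | i + 1 =>
      -- Entry `2j + 1` is message `j`. Entry `2j + 2` holds coins exactly if message `j` exists and
      -- is not `halt`. In both cases `j = i / 2`.
      if Odd (i + 1) then (μ (i / 2)).elim (Sum.inr (Sum.inr ())) fun m => Sum.inr (Sum.inl m)
      else (μ (i / 2)).elim (Sum.inr (Sum.inr ())) fun m =>
        if m = haltMsg then Sum.inr (Sum.inr ()) else Sum.inl (c (i + 1))

theorem measurable_assembleView (c : ℕ → Coins) : Measurable (assembleView c) := by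
  refine measurable_pi_lambda _ fun i => ?_
  cases i with
  | zero => exact measurable_const
  | succ i =>
    by_cases h : Odd (i + 1) <;> simp only [assembleView, h, if_true, if_false]
    · exact (measurable_from_top (f := fun o : Option Str => (o.elim (Sum.inr (Sum.inr ()))
        fun m => Sum.inr (Sum.inl m) : ViewEntry))).comp (measurable_pi_apply _)
    · exact (measurable_from_top (f := fun o : Option Str => (o.elim (Sum.inr (Sum.inr ()))
        fun m => if m = haltMsg then Sum.inr (Sum.inr ()) else Sum.inl (c (i + 1)) :
          ViewEntry))).comp (measurable_pi_apply _)

theorem view_eq_assembleView (A M : InteractiveAlgorithm) (x : Str) (ω : ℕ → Coins) :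
    view A M x ω = assembleView ω (messages A M x ω) := by
  funext i
  cases i with
  | zero => rfl
  | succ i =>
    by_cases h : Odd (i + 1)
    · have hi : 2 * (i / 2) + 1 = i + 1 := by
        rcases h with ⟨k, hk⟩
        omega
      simp only [view, assembleView, messages, h, if_true, hi]
      cases interaction A M x ω (i + 1) <;> rfl
    · have hi : 2 * (i / 2) + 1 = i := by
        rcases Nat.not_odd_iff_even.1 h with ⟨k, hk⟩
        omega
      simp only [view, assembleView, messages, h, if_false, hi]
      cases interaction A M x ω i <;> rfl

theorem assembleView_congr {c c' : ℕ → Coins} (h : ∀ i, Even i → c i = c' i)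
    (μ : ℕ → Option Str) : assembleView c μ = assembleView c' μ := by
  funext i
  cases i with
  | zero => simp [assembleView, h 0 (by simp)]
  | succ i =>
    by_cases ho : Odd (i + 1)
    · simp only [assembleView, ho, if_true]
    · simp only [assembleView, ho, if_false, h _ (Nat.not_odd_iff_even.1 ho)]

/-! ### Fixing the coins of the adversary -/

section HardwiredCoins

variable (A : InteractiveAlgorithm) (c : ℕ → Coins) (enc : ℕ × Str → Str) (dec : Str → ℕ × Str)

/-- The adversary `A` with fixed coins `c (2t + 2)` in its `t`-th step; it keeps `t` in its
state. -/
def hardwire (henc : ∀ s, enc s ≠ []) : InteractiveAlgorithm where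
  step s q _ := (A.step (dec s).2 q (c (2 * (dec s).1 + 2))).map
    fun o => (enc ((dec s).1 + 1, o.1), o.2)
  measurable_step s q := FiberMeasurable.const _
  nonempty_output := by
    intro s q r s' a h
    simp only [Option.map_eq_some_iff, Prod.mk.injEq] at h
    obtain ⟨o, ho, rfl, rfl⟩ := h
    exact ⟨henc _, (A.nonempty_output _ _ _ _ _ ho).2⟩

variable {enc dec}

/-- The second conjunct makes the induction work: in an even round `i + 1` the counter is `i / 2`,
so the hardwired coins `c (2 * (i / 2) + 2)` are those of the current round. -/
theorem interaction_hardwire (henc : ∀ s, enc s ≠ []) (hdec : ∀ s, dec (enc s) = s)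
    (hnil : dec [] = (0, [])) (M : InteractiveAlgorithm) (x : Str) (ω : ℕ → Coins) (i : ℕ) :
    interaction A M x (mergeCoins c ω) i =
      (interaction (hardwire A c enc dec henc) M x ω i).map
        (fun d => (d.1, (dec d.2.1).2, d.2.2)) ∧
    ∀ d, interaction (hardwire A c enc dec henc) M x ω i = some d → (dec d.2.1).1 = i / 2 := by
  induction i with
  | zero => simp [interaction, hnil]
  | succ i ih =>
    obtain ⟨ih1, ih2⟩ := ih
    simp only [interaction, ih1]
    cases hd : interaction (hardwire A c enc dec henc) M x ω i with
    | none => simp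
    | some d =>
      have hcount := ih2 d hd
      by_cases hh : d.2.2 = haltMsg
      · simp [hh]
      by_cases ho : Odd (i + 1)
      · have hne : ¬ Even (i + 1) := Nat.not_even_iff_odd.2 ho
        simp only [Option.map_some, Option.bind_some, hh, ho, if_true, if_false, mergeCoins, hne,
          Option.map_map]
        refine ⟨rfl, fun d' hd' => ?_⟩
        simp only [Option.map_eq_some_iff] at hd'
        obtain ⟨o, -, rfl⟩ := hd'
        rw [hcount]
        rcases ho with ⟨k, hk⟩
        omega
      · have he : Even (i + 1) := Nat.not_odd_iff_even.1 ho
        have hi : 2 * (i / 2) + 2 = i + 1 := by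
          rcases he with ⟨k, hk⟩
          omega
        simp only [Option.map_some, Option.bind_some, hh, ho, if_false, mergeCoins, he, if_true,
          Option.map_map, hardwire, hcount, hi]
        refine ⟨?_, fun d' hd' => ?_⟩
        · congr 1
          funext o
          simp [hdec]
        · simp only [Option.map_eq_some_iff] at hd'
          obtain ⟨o, -, rfl⟩ := hd'
          simp only [Function.comp, hdec]
          omega

theorem messages_hardwire (henc : ∀ s, enc s ≠ []) (hdec : ∀ s, dec (enc s) = s)
    (hnil : dec [] = (0, [])) (M : InteractiveAlgorithm) (x : Str) (ω : ℕ → Coins) :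
    messages A M x (mergeCoins c ω) = messages (hardwire A c enc dec henc) M x ω := by
  funext j
  simp only [messages, (interaction_hardwire A c henc hdec hnil M x ω (2 * j + 1)).1,
    Option.map_map]
  rfl

end HardwiredCoins

/-- The law of the view of `A`, given its coins. -/
noncomputable def viewKernel (A M : InteractiveAlgorithm) (x : Str) : Kernel (ℕ → Coins) View :=
  (Kernel.id ×ₖ Kernel.const _ (Measure.infinitePi fun _ : ℕ => coinLaw)).map
    fun p => view A M x (mergeCoins p.1 p.2)

theorem measurable_view_merge (A M : InteractiveAlgorithm) (x : Str) :
    Measurable fun p : (ℕ → Coins) × (ℕ → Coins) => view A M x (mergeCoins p.1 p.2) :=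
  (measurable_view A M x).comp measurable_mergeCoins

instance instIsMarkovKernelViewKernel (A M : InteractiveAlgorithm) (x : Str) :
    IsMarkovKernel (viewKernel A M x) :=
  Kernel.IsMarkovKernel.map _ (measurable_view_merge A M x)

theorem viewKernel_apply (A M : InteractiveAlgorithm) (x : Str) (c : ℕ → Coins) :
    viewKernel A M x c = (Measure.infinitePi fun _ : ℕ => coinLaw).map
      fun ω => view A M x (mergeCoins c ω) := by
  rw [viewKernel, Kernel.map_apply _ (measurable_view_merge A M x), Kernel.prod_apply,
    Kernel.id_apply, Kernel.const_apply, Measure.dirac_prod,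
    Measure.map_map (measurable_view_merge A M x) (by fun_prop)]
  rfl

/-- Fubini: coins in even and odd rounds are independent, so averaging over the first factor of
`map_mergeCoins` restores fully random coins. -/
theorem bind_viewKernel (A M : InteractiveAlgorithm) (x : Str) :
    (Measure.infinitePi fun _ : ℕ => coinLaw).bind (viewKernel A M x) =
      (Measure.infinitePi fun _ : ℕ => coinLaw).map (view A M x) := by
  conv_rhs => rw [← map_mergeCoins coinLaw,
    Measure.map_map (measurable_view A M x) measurable_mergeCoins]
  ext s hs
  rw [Measure.bind_apply hs (Kernel.aemeasurable _),
    Measure.map_apply ((measurable_view A M x).comp measurable_mergeCoins) hs,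
    Measure.prod_apply (((measurable_view A M x).comp measurable_mergeCoins) hs)]
  refine lintegral_congr fun c => ?_
  rw [viewKernel_apply]
  exact Measure.map_apply ((measurable_view_merge A M x).comp measurable_prodMk_left) hs

/-- It suffices to consider the messages received by deterministic adversaries. -/
theorem dist_viewLaw_le {𝒟 : Type*} [PartialOrder 𝒟] (D : GeneralizedProbabilityDistance 𝒟)
    (d : 𝒟) (M : InteractiveAlgorithm) (x x' : Str)
    (h : ∀ A : InteractiveAlgorithm, A.IsDeterministic →
      D.dist (messagesLaw A M x) (messagesLaw A M x') ≤ d)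
    (A : InteractiveAlgorithm) : D.dist (viewLaw A M x) (viewLaw A M x') ≤ d := by
  obtain ⟨enc, dec, henc, hdec, hnil⟩ := exists_coding ((0, []) : ℕ × Str)
  have key : ∀ (c : ℕ → Coins) (y : Str),
      (⟨viewKernel A M y c, inferInstance⟩ : ProbabilityMeasure View) =
        (messagesLaw (hardwire A c enc dec henc) M y).map
          (measurable_assembleView c).aemeasurable := by
    intro c y
    apply Subtype.ext
    change viewKernel A M y c = ((Measure.infinitePi fun _ : ℕ => coinLaw).map
      (messages (hardwire A c enc dec henc) M y)).map (assembleView c)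
    rw [viewKernel_apply, Measure.map_map (measurable_assembleView c) (measurable_messages _ _ _)]
    congr 1
    funext ω
    rw [view_eq_assembleView, messages_hardwire A c henc hdec hnil]
    exact assembleView_congr (fun i hi => by simp [mergeCoins, hi]) _
  -- The random index is the coin sequence of the adversary; for each value of it, `key` presents
  -- both views as images of messages under the same map.
  have := D.jointConvexity ⟨Measure.infinitePi fun _ : ℕ => coinLaw, inferInstance⟩
    (viewKernel A M x) (viewKernel A M x') d fun c => by
      rw [key c x, key c x']
      exact (D.postprocessing _ (measurable_assembleView c) _ _).trans
        (h _ fun _ _ _ _ => rfl)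
  convert this using 1
  congr 1
  · exact Subtype.ext (bind_viewKernel A M x).symm
  · exact Subtype.ext (bind_viewKernel A M x').symm

/-! ### The joint evolution of the adversary, the person in the middle and the mechanism -/

/-- What happens next: `M` is called, `P` receives an answer of `M`, a message is delivered to the
adversary (whose answer goes to `P`), or nothing any more. -/
inductive Phase
  | query
  | answer
  | deliver
  | ended

instance instCountablePhase : Countable Phase :=
  Function.Injective.countable (f := fun v : Phase => match v with
    | .query => 0 | .answer => 1 | .deliver => 2 | .ended => (3 : ℕ))
    (by intro v w; cases v <;> cases w <;> simp)

/-- The phase after a message of `P` with the given tag. -/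
def Tag.phase : Tag → Phase
  | .Q => .query
  | .A => .deliver

/-- A joint configuration: the next phase, the states of `M`, `P` and the adversary, the message
on its way, the number of messages delivered to the adversary, the number of passes through the
loop of `P ∘ M` since then, and the number of calls of `M`. -/
structure Config where
  phase : Phase
  mechanism : Option Str
  middle : Str
  message : Str
  adversary : Str
  round : ℕ
  pass : ℕ
  calls : ℕ

instance instCountableConfig : Countable Config :=
  Function.Injective.countable (f := fun s : Config =>
    (s.phase, s.mechanism, s.middle, s.message, s.adversary, s.round, s.pass, s.calls))
    (by rintro ⟨⟩ ⟨⟩ h; simpa using h)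

instance instMeasurableSpaceConfig : MeasurableSpace Config := ⊤

instance instMeasurableSingletonClassConfig : MeasurableSingletonClass Config := ⟨fun _ => trivial⟩

/-- The configuration at the beginning, when `M` has the state `t`. -/
def Config.init (t : Str) : Config := ⟨.query, some t, [], [], [], 0, 0, 0⟩

section Step

variable (A : InteractiveAlgorithm) (P : PIM) (M : InteractiveAlgorithm)

/-- The answer of a deterministic adversary that does not end the interaction. -/
def reply (s m : Str) : Option (Str × Str) :=
  if m = haltMsg then none
  else (A.step s m fun _ => false).bind fun o => if o.2 = haltMsg then none else some o

/-- One step of the joint evolution. -/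
def Config.next (s : Config) (r : Coins) : Config :=
  match s.phase with
  | .query => (callMechanism M s.mechanism s.message r).elim
      { s with phase := .ended, calls := s.calls + 1 }
      fun c => { s with
        phase := .answer, mechanism := c.1, message := c.2, calls := s.calls + 1 }
  | .answer => (P.step s.middle Tag.A s.message r).elim { s with phase := .ended }
      fun o => { s with
        phase := o.2.1.phase, middle := o.1, message := o.2.2, pass := s.pass + 1 }
  -- The reply of `A` needs no coins, so it shares a step with the reaction of `P`; every step then
  -- reads at most one coin sequence.
  | .deliver => (reply A s.adversary s.message).elim { s with phase := .ended }
      fun a => (P.step s.middle Tag.Q a.2 r).elim { s with phase := .ended }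
        fun o => { s with
          phase := o.2.1.phase, middle := o.1, message := o.2.2, adversary := a.1,
          round := s.round + 1, pass := 0 }
  | .ended => s

theorem fiberMeasurable_next (s : Config) : FiberMeasurable (s.next A P M) := by
  obtain ⟨ph, t, sP, m, sA, j, k, q⟩ := s
  cases ph with
  | query => exact (fiberMeasurable_callMechanism M t m).map fun o => o.elim _ _
  | answer => exact (P.measurable_step sP Tag.A m).map fun o => o.elim _ _
  | deliver =>
    change FiberMeasurable fun r => (reply A sA m).elim _ _
    cases reply A sA m with
    | none => exact FiberMeasurable.const _
    | some a => exact (P.measurable_step sP Tag.Q a.2).map fun o => o.elim _ _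
  | ended => exact FiberMeasurable.const _

/-! #### Coins in the interaction of the adversary with `P ∘ M` -/

/-- The coins used in the interaction with `P ∘ M`: `Sum.inr (j, s)` stands for the `s`-th stream
of the coins of round `2j + 1`. -/
def outerCoins (ω : ℕ → Coins) : ℕ ⊕ (ℕ × ℕ) → Coins
  | .inl n => stream (ω 0) n
  | .inr (j, s) => stream (ω (2 * j + 1)) s

/-- Which coins are used next in the interaction with `P ∘ M`. -/
def outerAddr (n : ℕ) (s : Config) : ℕ ⊕ (ℕ × ℕ) :=
  match s.phase with
  | .query => .inr (s.round, 2 * s.pass + 1)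
  | .answer => .inr (s.round, 2 * s.pass + 2)
  -- The reaction of `P` to the reply of `A` opens the next run of the loop, where `loopStart` uses
  -- stream `0`.
  | .deliver => .inr (s.round + 1, 0)
  -- After the end, the coins are immaterial; round `0`, indexed by time, is used only to keep the
  -- addresses fresh.
  | .ended => .inl n

theorem map_outerCoins : (Measure.infinitePi fun _ : ℕ => coinLaw).map outerCoins =
    Measure.infinitePi fun _ => coinLaw := by
  rw [← map_coins_of_injective (fun (a : ℕ ⊕ (ℕ × ℕ)) b =>
    a.elim (fun n => (0, Nat.pair n b)) fun p => (2 * p.1 + 1, Nat.pair p.2 b))]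
  · congr 1
    funext ω a b
    rcases a with n | ⟨j, s⟩ <;> rfl
  · rintro ⟨n | ⟨j, s⟩, b⟩ ⟨n' | ⟨j', s'⟩, b'⟩ h
    all_goals simp only [Sum.elim_inl, Sum.elim_inr, Prod.mk.injEq, Nat.pair_eq_pair, true_and] at h
    · simp [h]
    · omega
    · omega
    · obtain ⟨h1, rfl, rfl⟩ := h
      obtain rfl : j = j' := by omega
      rfl

/-- Until the end, the pair of round and stream increases lexicographically: streams `1, 2, 3, …` in
the passes of one run, then stream `0` of the next round. -/
theorem outerAddr_next (s : Config) (r : Coins) (n n' : ℕ) :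
    (s.next A P M r).phase = .ended ∨ ∃ p p', outerAddr n s = .inr p ∧
      outerAddr n' (s.next A P M r) = .inr p' ∧ (p.1 < p'.1 ∨ p.1 = p'.1 ∧ p.2 < p'.2) := by
  obtain ⟨ph, t, sP, m, sA, j, k, q⟩ := s
  cases ph with
  | query =>
    simp only [Config.next]
    rcases callMechanism M t m r with - | c
    · exact Or.inl rfl
    · exact Or.inr ⟨_, _, rfl, rfl, Or.inr ⟨rfl, by simp⟩⟩
  | answer =>
    simp only [Config.next]
    rcases P.step sP Tag.A m r with - | ⟨sP', v, m'⟩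
    · exact Or.inl rfl
    · cases v
      · exact Or.inr ⟨_, _, rfl, rfl, Or.inr ⟨rfl, by simp; omega⟩⟩
      · exact Or.inr ⟨_, _, rfl, rfl, Or.inl (by simp)⟩
  | deliver =>
    simp only [Config.next]
    rcases reply A sA m with - | a
    · exact Or.inl rfl
    rcases h : P.step sP Tag.Q a.2 r with - | ⟨sP', v, m'⟩
    · simp [h]
    · cases v
      · exact Or.inr ⟨(j + 1, 0), (j + 1, 1), rfl, by simp only [Option.elim, h]; rfl, by simp⟩
      · exact Or.inr ⟨(j + 1, 0), (j + 2, 0), rfl, by simp only [Option.elim, h]; rfl, by simp⟩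
  | ended => exact Or.inl rfl

theorem freshAddresses_outer : FreshAddresses (Config.next A P M) outerAddr := by
  intro s n hs k hk
  have key : ∀ l, k < l → l ≤ n → (s l).phase = .ended ∨ ∃ p p', outerAddr k (s k) = .inr p ∧
      outerAddr l (s l) = .inr p' ∧ (p.1 < p'.1 ∨ p.1 = p'.1 ∧ p.2 < p'.2) := by
    intro l hl
    induction l, hl using Nat.le_induction with
    | base =>
      intro hn
      obtain ⟨r, hr⟩ := hs k hn
      rw [← hr]
      exact outerAddr_next A P M (s k) r k (k + 1)
    | succ l hl ih =>
      intro hn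
      obtain ⟨r, hr⟩ := hs l hn
      rcases ih (by omega) with hended | ⟨p, p', hp, hp', hlt⟩
      · left
        rw [← hr, Config.next, hended]
        exact hended
      · rw [← hr]
        refine (outerAddr_next A P M (s l) r l (l + 1)).imp id ?_
        rintro ⟨q, q', hq, hq', hlt'⟩
        obtain rfl : p' = q := Sum.inr.inj (hp'.symm.trans hq)
        exact ⟨p, q', hp, hq', by omega⟩
  rcases key n hk le_rfl with hended | ⟨p, p', hp, hp', hlt⟩
  · have h1 : outerAddr n (s n) = .inl n := by simp [outerAddr, hended]
    rw [h1]
    unfold outerAddr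
    cases (s k).phase <;> simp
    omega
  · rw [hp, hp']
    intro h
    obtain rfl := Sum.inr.inj h
    omega

/-! #### Coins in the interaction with `M` -/

/-- The coins used in the interaction of an emulation of `P` and the adversary with `M`:
`Sum.inl q` stands for the coins of round `2q + 1` and `Sum.inr (i, n)` for the `n`-th stream of the
coins of round `2i`. -/
def innerCoins (ω : ℕ → Coins) : ℕ ⊕ (ℕ × ℕ) → Coins
  | .inl q => ω (2 * q + 1)
  | .inr (i, n) => stream (ω (2 * i)) n

/-- Half the number of the round whose coins are used for the emulation: the current round, or round
`0` if the interaction with `M` is over. -/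
def Config.emulationRound (s : Config) : ℕ := if s.mechanism = none then 0 else s.calls

/-- Which coins are used next in the interaction with `M`. -/
def innerAddr (n : ℕ) (s : Config) : ℕ ⊕ (ℕ × ℕ) :=
  match s.phase, s.mechanism with
  | .query, some _ => .inl s.calls
  -- Using the time as the stream number excludes repetitions, also when the steps after the end of
  -- the contact with `M` go back to round `0`.
  | _, _ => .inr (s.emulationRound, n)

theorem map_innerCoins : (Measure.infinitePi fun _ : ℕ => coinLaw).map innerCoins =
    Measure.infinitePi fun _ => coinLaw := by
  rw [← map_coins_of_injective (fun (a : ℕ ⊕ (ℕ × ℕ)) b =>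
    a.elim (fun q => (2 * q + 1, b)) fun p => (2 * p.1, Nat.pair p.2 b))]
  · congr 1
    funext ω a b
    rcases a with n | ⟨j, s⟩ <;> rfl
  · rintro ⟨n | ⟨j, s⟩, b⟩ ⟨n' | ⟨j', s'⟩, b'⟩ h
    all_goals simp only [Sum.elim_inl, Sum.elim_inr, Prod.mk.injEq, Nat.pair_eq_pair] at h
    · obtain ⟨h1, rfl⟩ := h
      obtain rfl : n = n' := by omega
      rfl
    · omega
    · omega
    · obtain ⟨h1, rfl, rfl⟩ := h
      obtain rfl : j = j' := by omega
      rfl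

theorem calls_next (s : Config) (r : Coins) :
    s.calls ≤ (s.next A P M r).calls ∧
      (s.phase = .query → s.calls < (s.next A P M r).calls) := by
  obtain ⟨ph, t, sP, m, sA, j, k, q⟩ := s
  cases ph with
  | query => simp only [Config.next]; rcases callMechanism M t m r with - | c <;> simp
  | answer => simp only [Config.next]; rcases P.step sP Tag.A m r with - | c <;> simp
  | deliver =>
    simp only [Config.next]
    rcases reply A sA m with - | a
    · simp
    · simp only [Option.elim]
      rcases P.step sP Tag.Q a.2 r with - | c <;> simp
  | ended => simp [Config.next]

/-- Two calls of `M` have different addresses because the call counter grows strictly at each call;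
emulated steps carry their time. -/
theorem freshAddresses_inner : FreshAddresses (Config.next A P M) innerAddr := by
  intro s n hs k hk
  have step : ∀ l < n, (s l).calls ≤ (s (l + 1)).calls ∧
      ((s l).phase = .query → (s l).calls < (s (l + 1)).calls) := fun l hl => by
    obtain ⟨r, hr⟩ := hs l hl
    rw [← hr]
    exact calls_next A P M (s l) r
  have mono : ∀ l, k < l → l ≤ n → (s (k + 1)).calls ≤ (s l).calls := by
    intro l hl
    induction l, hl using Nat.le_induction with
    | base => exact fun _ => le_rfl
    | succ l hl ih => exact fun hn => (ih (by omega)).trans (step l (by omega)).1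
  intro h
  unfold innerAddr at h
  split at h <;> split at h
  · rename_i hq _ _ _ _ _ _
    have h1 := (step k hk).2 hq
    have h2 := mono n hk le_rfl
    have := Sum.inl.inj h
    omega
  · simp at h
  · simp at h
  · simp only [Sum.inr.injEq, Prod.mk.injEq] at h
    omega

/-! #### Messages delivered to the adversary -/

/-- The messages delivered to the adversary along a sequence of configurations. -/
noncomputable def delivered (s : ℕ → Config) (j : ℕ) : Option Str :=
  firstSome fun n => match (s n).phase with
    | .deliver => if (s n).round = j then some (s n).message else none
    | _ => none

theorem measurable_delivered : Measurable delivered := by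
  refine measurable_pi_lambda _ fun j => FiberMeasurable.measurable ?_
  refine fiberMeasurable_firstSome (g := fun n (s : ℕ → Config) => match (s n).phase with
    | .deliver => if (s n).round = j then some (s n).message else none
    | _ => none) fun n => ?_
  exact (Measurable.fiberMeasurable (g := fun s : ℕ → Config => s n) (measurable_pi_apply n)).map
    fun s => match s.phase with
      | .deliver => if s.round = j then some s.message else none
      | _ => none

end Step

/-! ### The interaction with `P ∘ M` -/

theorem interaction_odd (A M : InteractiveAlgorithm) (x : Str) (ω : ℕ → Coins) (j : ℕ) :
    interaction A M x ω (2 * j + 1) = (interaction A M x ω (2 * j)).bind fun c =>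
      if c.2.2 = haltMsg then none
      else (M.step c.1 c.2.2 (ω (2 * j + 1))).map fun o => (o.1, c.2.1, o.2) := by
  simp only [interaction, odd_two_mul_add_one, if_true]

theorem interaction_even (A M : InteractiveAlgorithm) (x : Str) (ω : ℕ → Coins) (j : ℕ) :
    interaction A M x ω (2 * j + 2) = (interaction A M x ω (2 * j + 1)).bind fun c =>
      if c.2.2 = haltMsg then none
      else (A.step c.2.1 c.2.2 (ω (2 * j + 2))).map fun o => (c.1, o.1, o.2) := by
  have h : ¬ Odd (2 * j + 1 + 1) := by simp [parity_simps]
  conv_lhs => unfold interaction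
  simp only [h, if_false]

theorem loopIter_of_le {P : PIM} {M : InteractiveAlgorithm} {s m : Str} {r : Coins} {k l : ℕ}
    (hkl : k ≤ l) {t : Option Str} {sP a : Str}
    (h : loopIter P M s m r k = some (t, sP, Tag.A, a)) :
    loopIter P M s m r l = some (t, sP, Tag.A, a) := by
  induction l, hkl using Nat.le_induction with
  | base => exact h
  | succ l _ ih => simp [loopIter, ih, loopBody]

theorem compStep_eq_firstSome (P : PIM) (M : InteractiveAlgorithm) (s m : Str) (r : Coins) :
    compStep P M s m r = firstSome fun k => (loopIter P M s m r k).bind loopOutput := rfl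

theorem loopIter_bind_loopOutput {P : PIM} {M : InteractiveAlgorithm} {s m : Str} {r : Coins}
    {k : ℕ} {y : Str × Str} (h : (loopIter P M s m r k).bind loopOutput = some y) :
    ∃ t sP a, loopIter P M s m r k = some (t, sP, Tag.A, a) ∧ y = (packState t sP, a) := by
  obtain ⟨⟨t, sP, v, a⟩, h1, h2⟩ := Option.bind_eq_some_iff.1 h
  cases v with
  | Q => simp [loopOutput] at h2
  | A => exact ⟨t, sP, a, h1, (Option.some.inj h2).symm⟩

/-- The loop freezes once `v = A`, so all exits that are found agree and the minimality of the
chosen index is irrelevant. -/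
theorem compStep_eq_some {P : PIM} {M : InteractiveAlgorithm} {s m : Str} {r : Coins} {k : ℕ}
    {t : Option Str} {sP a : Str} (h : loopIter P M s m r k = some (t, sP, Tag.A, a)) :
    compStep P M s m r = some (packState t sP, a) := by
  rw [compStep_eq_firstSome]
  refine firstSome_eq_of_forall (k := k) (by simp [h, loopOutput]) fun l y hl => ?_
  obtain ⟨t', sP', a', h', rfl⟩ := loopIter_bind_loopOutput hl
  have h1 := loopIter_of_le (le_max_left k l) h
  rw [loopIter_of_le (le_max_right k l) h'] at h1
  simp only [Option.some.injEq, Prod.mk.injEq] at h1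
  obtain ⟨rfl, rfl, -, rfl⟩ := h1
  rfl

theorem exists_loopIter_of_compStep {P : PIM} {M : InteractiveAlgorithm} {s m : Str} {r : Coins}
    {y : Str × Str} (h : compStep P M s m r = some y) :
    ∃ k t sP, loopIter P M s m r k = some (t, sP, Tag.A, y.2) ∧ y.1 = packState t sP := by
  rw [compStep_eq_firstSome] at h
  obtain ⟨k, hk⟩ := firstSome_eq_some h
  obtain ⟨t, sP, a, h', rfl⟩ := loopIter_bind_loopOutput hk
  exact ⟨k, t, sP, h', rfl⟩

theorem reply_eq_some {A : InteractiveAlgorithm} {s m : Str} {o : Str × Str} :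
    reply A s m = some o ↔
      m ≠ haltMsg ∧ A.step s m (fun _ => false) = some o ∧ o.2 ≠ haltMsg := by
  unfold reply
  by_cases h : m = haltMsg
  · simp [h]
  · simp only [h, if_false, Option.bind_eq_some_iff, ne_eq, not_false_eq_true, true_and]
    constructor
    · rintro ⟨o', h1, h2⟩
      split_ifs at h2 with h3
      obtain rfl := Option.some.inj h2
      exact ⟨h1, h3⟩
    · rintro ⟨h1, h2⟩
      exact ⟨o, h1, by simp [h2]⟩

section Outer

variable (A : InteractiveAlgorithm) (P : PIM) (M : InteractiveAlgorithm) (x : Str) (ω : ℕ → Coins)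

/-- The configuration that corresponds to variables of the loop of `P ∘ M`. -/
def Config.ofLoop (l : LoopState) (sA : Str) (j k q : ℕ) : Config :=
  ⟨l.2.2.1.phase, l.1, l.2.1, l.2.2.2, sA, j, k, q⟩

/-- The configurations during the interaction of the adversary with `P ∘ M`. -/
def outerChain : ℕ → Config :=
  chain (Config.next A P M) outerAddr (Config.init x) (outerCoins ω)

/-- The configuration `s` occurs in the interaction of the adversary with `P ∘ M`. -/
def OuterReached (s : Config) : Prop :=
  ∃ t m, interaction A (P.comp M) x ω (2 * s.round) = some (t, s.adversary, m) ∧ m ≠ haltMsg ∧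
    match s.phase with
    | .query => loopIter P M t m (ω (2 * s.round + 1)) s.pass =
        some (s.mechanism, s.middle, Tag.Q, s.message)
    -- This configuration lies inside a pass: `M` has answered the query `q`, and `P` has not yet
    -- processed the answer.
    | .answer => ∃ u q, loopIter P M t m (ω (2 * s.round + 1)) s.pass =
          some (u, s.middle, Tag.Q, q) ∧
        callMechanism M u q (stream (ω (2 * s.round + 1)) (2 * s.pass + 1)) =
          some (s.mechanism, s.message)
    | .deliver => loopIter P M t m (ω (2 * s.round + 1)) s.pass =
        some (s.mechanism, s.middle, Tag.A, s.message)
    | .ended => True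

variable {A P M x ω}

theorem OuterReached.interaction_eq {s : Config} (hs : OuterReached A P M x ω s)
    (hd : s.phase = .deliver) : interaction A (P.comp M) x ω (2 * s.round + 1) =
      some (packState s.mechanism s.middle, s.adversary, s.message) := by
  obtain ⟨t, m, h1, h2, h3⟩ := hs
  simp only [hd] at h3
  rw [interaction_odd, h1, Option.bind_some, if_neg h2]
  change (compStep P M _ _ _).map _ = _
  rw [compStep_eq_some h3]
  rfl

theorem OuterReached.ofLoop {sA t m : Str} {l : LoopState} {j k q : ℕ}
    (h1 : interaction A (P.comp M) x ω (2 * j) = some (t, sA, m)) (h2 : m ≠ haltMsg)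
    (h3 : loopIter P M t m (ω (2 * j + 1)) k = some l) :
    OuterReached A P M x ω (Config.ofLoop l sA j k q) := by
  obtain ⟨u, sP, v, a⟩ := l
  refine ⟨t, m, h1, h2, ?_⟩
  cases v <;> exact h3

theorem interaction_reply (hA : A.IsDeterministic) {N : InteractiveAlgorithm} {j : ℕ}
    {t sA m : Str} {o : Str × Str} (h : interaction A N x ω (2 * j + 1) = some (t, sA, m))
    (ho : reply A sA m = some o) : interaction A N x ω (2 * j + 2) = some (t, o.1, o.2) := by
  obtain ⟨h1, h2, -⟩ := reply_eq_some.1 ho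
  rw [interaction_even, h, Option.bind_some, if_neg h1, hA _ _ _ fun _ => false, h2]
  rfl

theorem loopStart_pack {u : Option Str} {sP m : Str} (hm : m ≠ []) (r : Coins) :
    loopStart P (packState u sP) m r =
      (P.step sP Tag.Q m (stream r 0)).map fun o => (u, o) := by
  simp [loopStart, hm, unpackState_packState]

/-- `outerAddr` selects exactly the stream that `loopIter` uses for the same computation. -/
theorem OuterReached.next (hA : A.IsDeterministic) {s : Config} (hs : OuterReached A P M x ω s)
    (n : ℕ) (hns : (s.next A P M (outerCoins ω (outerAddr n s))).phase ≠ .ended) :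
    OuterReached A P M x ω (s.next A P M (outerCoins ω (outerAddr n s))) := by
  obtain ⟨ph, u, sP, msg, sA, j, k, q⟩ := s
  cases ph with
  | query =>
    obtain ⟨t, m, h1, h2, h3⟩ := hs
    simp only [Config.next, outerAddr, outerCoins] at hns ⊢
    rcases hc : callMechanism M u msg (stream (ω (2 * j + 1)) (2 * k + 1)) with - | c
    · simp [hc] at hns
    · exact ⟨t, m, h1, h2, u, msg, h3, hc⟩
  | answer =>
    obtain ⟨t, m, h1, h2, u', q', h3, h4⟩ := hs
    simp only [Config.next, outerAddr, outerCoins] at hns ⊢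
    rcases hc : P.step sP Tag.A msg (stream (ω (2 * j + 1)) (2 * k + 2)) with - | o
    · simp [hc] at hns
    · refine OuterReached.ofLoop (l := (u, o)) h1 h2 ?_
      change loopIter P M t m (ω (2 * j + 1)) k = _ at h3
      change callMechanism M u' q' (stream (ω (2 * j + 1)) (2 * k + 1)) = _ at h4
      simp [loopIter, h3, loopBody, h4, hc]
  | deliver =>
    have hodd := hs.interaction_eq rfl
    simp only [Config.next, outerAddr, outerCoins] at hns hodd ⊢
    rcases hr : reply A sA msg with - | a
    · simp [hr] at hns
    rcases hc : P.step sP Tag.Q a.2 (stream (ω (2 * (j + 1) + 1)) 0) with - | o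
    · simp [hr, hc] at hns
    have hh := reply_eq_some.1 hr
    simp only [Option.elim, hc]
    refine OuterReached.ofLoop (l := (u, o)) (k := 0) (interaction_reply hA hodd hr) hh.2.2 ?_
    simp only [loopIter]
    rw [loopStart_pack (A.nonempty_output _ _ _ _ _ hh.2.1).2, hc]
    rfl
  | ended => exact absurd rfl hns

theorem outerReached_outerChain (hA : A.IsDeterministic) (n : ℕ)
    (hns : (outerChain A P M x ω n).phase ≠ .ended) :
    OuterReached A P M x ω (outerChain A P M x ω n) := by
  induction n with
  | zero =>
    refine OuterReached.ofLoop (t := x) (m := []) (l := (some x, [], Tag.Q, [])) rfl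
      (by simp [haltMsg]) ?_
    simp [loopIter, loopStart]
  | succ n ih =>
    refine (ih fun h => hns ?_).next hA n hns
    change (Config.next A P M (outerChain A P M x ω n) _).phase = _
    rw [Config.next, h]
    exact h

/-- Converse to `OuterReached`: one pass through the loop is two steps of the chain. After the exit
`loopIter` idles while the chain moves on, so `k'` equals `k` only as long as `v = Q`. -/
theorem exists_outerChain_of_loopIter {t m sA : Str} {j : ℕ}
    (hstart : ∀ l, loopStart P t m (ω (2 * j + 1)) = some l →
      ∃ n q, outerChain A P M x ω n = Config.ofLoop l sA j 0 q)
    (k : ℕ) (l : LoopState) (h : loopIter P M t m (ω (2 * j + 1)) k = some l) :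
    ∃ n k' q, outerChain A P M x ω n = Config.ofLoop l sA j k' q ∧ (l.2.2.1 = Tag.Q → k' = k) := by
  induction k generalizing l with
  | zero =>
    obtain ⟨n, q, hn⟩ := hstart l h
    exact ⟨n, 0, q, hn, fun _ => rfl⟩
  | succ k ih =>
    obtain ⟨⟨u, sP, v, a⟩, h1, h2⟩ := Option.bind_eq_some_iff.1 h
    obtain ⟨n, k', q, hn, hk⟩ := ih _ h1
    cases v with
    | A =>
      obtain rfl := Option.some.inj h2
      exact ⟨n, k', q, hn, fun h => by cases h⟩
    | Q =>
      obtain rfl := hk rfl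
      obtain ⟨c, hc, h3⟩ := Option.bind_eq_some_iff.1 h2
      obtain ⟨o, ho, rfl⟩ := Option.map_eq_some_iff.1 h3
      have hn1 : outerChain A P M x ω (n + 1) = ⟨.answer, c.1, sP, c.2, sA, j, k', q + 1⟩ := by
        change Config.next A P M (outerChain A P M x ω n)
          (outerCoins ω (outerAddr n (outerChain A P M x ω n))) = _
        rw [hn]
        simp [Config.ofLoop, Tag.phase, Config.next, outerAddr, outerCoins, hc]
      refine ⟨n + 2, k' + 1, q + 1, ?_, fun _ => rfl⟩
      change Config.next A P M (outerChain A P M x ω (n + 1))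
        (outerCoins ω (outerAddr (n + 1) (outerChain A P M x ω (n + 1)))) = _
      rw [hn1]
      simp [Config.ofLoop, Config.next, outerAddr, outerCoins, ho]

theorem exists_outerChain_of_compStep {t m sA : Str} {j : ℕ}
    (hstart : ∀ l, loopStart P t m (ω (2 * j + 1)) = some l →
      ∃ n q, outerChain A P M x ω n = Config.ofLoop l sA j 0 q)
    {c : Str × Str × Str} (hi : interaction A (P.comp M) x ω (2 * j) = some (t, sA, m))
    (h : interaction A (P.comp M) x ω (2 * j + 1) = some c) :
    ∃ n k q u sP, outerChain A P M x ω n = ⟨.deliver, u, sP, c.2.2, c.2.1, j, k, q⟩ ∧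
      c.1 = packState u sP := by
  rw [interaction_odd, hi, Option.bind_some] at h
  split_ifs at h with hm
  obtain ⟨y, hy, rfl⟩ := Option.map_eq_some_iff.1 h
  obtain ⟨k, u, sP, hk, hy1⟩ := exists_loopIter_of_compStep hy
  obtain ⟨n, k', q, hn, -⟩ := exists_outerChain_of_loopIter hstart k _ hk
  exact ⟨n, k', q, u, sP, hn, hy1⟩

/-- Induction over rounds: the previous run of the loop ends in a `deliver` configuration of the
chain, and the next step of the chain enters the new run. -/
theorem exists_outerChain_loopStart (hA : A.IsDeterministic) (j : ℕ) (t sA m : Str)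
    (hi : interaction A (P.comp M) x ω (2 * j) = some (t, sA, m)) (hm : m ≠ haltMsg)
    (l : LoopState) (hl : loopStart P t m (ω (2 * j + 1)) = some l) :
    ∃ n q, outerChain A P M x ω n = Config.ofLoop l sA j 0 q := by
  induction j generalizing t sA m l with
  | zero =>
    simp only [interaction, Option.some.injEq, Prod.mk.injEq] at hi
    obtain ⟨rfl, rfl, rfl⟩ := hi
    simp only [loopStart, if_true, Option.some.injEq] at hl
    exact ⟨0, 0, by rw [← hl]; rfl⟩
  | succ j ih =>
    have hi' : interaction A (P.comp M) x ω (2 * j + 2) = some (t, sA, m) := hi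
    rw [interaction_even] at hi'
    obtain ⟨c, hc, h1⟩ := Option.bind_eq_some_iff.1 hi'
    split_ifs at h1 with hch
    obtain ⟨o, ho, h2⟩ := Option.map_eq_some_iff.1 h1
    simp only [Prod.mk.injEq] at h2
    obtain ⟨rfl, rfl, rfl⟩ := h2
    have hc' := hc
    rw [interaction_odd] at hc'
    obtain ⟨⟨t', sA', m'⟩, hi0, h3⟩ := Option.bind_eq_some_iff.1 hc'
    split_ifs at h3 with hm'
    obtain ⟨n, k, q, u, sP, hn, hcu⟩ :=
      exists_outerChain_of_compStep (fun l hl => ih t' sA' m' hi0 hm' l hl) hi0 hc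
    rw [hA _ _ _ fun _ => false] at ho
    rw [hcu, loopStart_pack (A.nonempty_output _ _ _ _ _ ho).2] at hl
    obtain ⟨p, hp, rfl⟩ := Option.map_eq_some_iff.1 hl
    refine ⟨n + 1, q, ?_⟩
    change Config.next A P M (outerChain A P M x ω n)
      (outerCoins ω (outerAddr n (outerChain A P M x ω n))) = _
    rw [hn]
    simp [Config.next, Config.ofLoop, outerAddr, outerCoins, reply_eq_some.2 ⟨hch, ho, hm⟩, hp]

/-- The adversary receives the messages delivered along the sequence of configurations. -/
theorem messages_comp (hA : A.IsDeterministic) :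
    messages A (P.comp M) x ω = delivered (outerChain A P M x ω) := by
  funext j
  have sound : ∀ n a, (match (outerChain A P M x ω n).phase with
      | .deliver => if (outerChain A P M x ω n).round = j
          then some (outerChain A P M x ω n).message else none
      | _ => none) = some a → messages A (P.comp M) x ω j = some a := by
    intro n a h
    split at h
    · rename_i hd
      split_ifs at h with hj
      have := (outerReached_outerChain hA n (by simp [hd])).interaction_eq hd
      rw [hj] at this
      simp only [messages, this, Option.map_some]
      exact h
    · simp at h
  unfold delivered
  rcases hm : messages A (P.comp M) x ω j with - | a
  · rcases hf : firstSome _ with - | b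
    · rfl
    · obtain ⟨n, hn⟩ := firstSome_eq_some hf
      rw [sound n b hn] at hm
      simp at hm
  · have hm' := hm
    obtain ⟨c, hc, rfl⟩ := Option.map_eq_some_iff.1 hm'
    have hc' := hc
    rw [interaction_odd] at hc'
    obtain ⟨⟨t, sA, m⟩, hi, h3⟩ := Option.bind_eq_some_iff.1 hc'
    split_ifs at h3 with hmh
    obtain ⟨n, k, q, u, sP, hn, -⟩ := exists_outerChain_of_compStep
      (fun l hl => exists_outerChain_loopStart hA j t sA m hi hmh l hl) hi hc
    -- By `sound`, every value that `firstSome` could select is the message itself.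
    refine (firstSome_eq_of_forall (k := n) (by simp [hn]) fun n' b hb => ?_).symm
    rw [sound n' b hb] at hm
    exact Option.some.inj hm

end Outer

/-! ### The emulation of `P` and the adversary in an interaction with `M` -/

/-- The part of a configuration that does not involve the state of `M`, except for whether the
interaction of `P` with `M` is over. -/
def Config.forget (s : Config) : Config := { s with mechanism := s.mechanism.map fun _ => [] }

section Inner

variable (A : InteractiveAlgorithm) (P : PIM) (M : InteractiveAlgorithm)

/-- The content of the state of `M` matters only when `M` is really run, and the hypothesis excludes
this. -/
theorem forget_next {s : Config} (hs : s.phase = .query → s.mechanism = none) (r : Coins) :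
    (s.next A P M r).forget = s.forget.next A P M r := by
  obtain ⟨ph, t, sP, m, sA, j, k, q⟩ := s
  cases ph with
  | query =>
    obtain rfl : t = none := hs rfl
    rfl
  | answer =>
    simp only [Config.forget, Config.next]
    rcases P.step sP Tag.A m r with - | o <;> rfl
  | deliver =>
    simp only [Config.forget, Config.next]
    rcases reply A sA m with - | a
    · rfl
    · simp only [Option.elim]
      rcases P.step sP Tag.Q a.2 r with - | o <;> rfl
  | ended => rfl

theorem next_spec {s : Config} (hs : s.phase = .answer ∨ s.phase = .deliver) (r : Coins) :
    (s.next A P M r).phase = .ended ∨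
      (s.next A P M r).mechanism = s.mechanism ∧ (s.next A P M r).calls = s.calls ∧
      ((s.next A P M r).phase = .query ∨ (s.next A P M r).phase = .deliver) ∧
      (s.next A P M r).message ≠ [] := by
  obtain ⟨ph, t, sP, m, sA, j, k, q⟩ := s
  cases ph with
  | query => simp at hs
  | answer =>
    simp only [Config.next]
    rcases h : P.step sP Tag.A m r with - | ⟨sP', v, m'⟩
    · exact Or.inl rfl
    · exact Or.inr ⟨rfl, rfl, by cases v <;> simp [Tag.phase],
        P.nonempty_message _ _ _ _ _ _ _ h⟩
  | deliver =>
    simp only [Config.next]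
    rcases reply A sA m with - | a
    · exact Or.inl rfl
    rcases h : P.step sP Tag.Q a.2 r with - | ⟨sP', v, m'⟩
    · simp [h]
    · simp only [Option.elim, h]
      exact Or.inr ⟨trivial, trivial, by cases v <;> simp [Tag.phase],
        P.nonempty_message _ _ _ _ _ _ _ h⟩
  | ended => simp at hs

/-- The emulation of `P` and the adversary with coins `r` after `M` has given the answer `a` in
the configuration `s` at time `n`, until the next call of `M`. -/
def emulation (n : ℕ) (s : Config) (a : Str) (r : Coins) : ℕ → Config
  | 0 => { s with phase := .answer, message := a, calls := s.calls + 1 }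
  | l + 1 => match (emulation n s a r l).phase with
    -- Ending after the first query leaves a single index at which the emulation can have output.
    | .query => { s with phase := .ended }
    -- The call of `M` takes place at time `n`, so index `l` of the emulation is time `n + 1 + l`,
    -- the stream number in `innerAddr`.
    | _ => (emulation n s a r l).next A P M (stream r (n + 1 + l))

theorem fiberMeasurable_emulation (n : ℕ) (s : Config) (a : Str) (l : ℕ) :
    FiberMeasurable fun r => emulation A P M n s a r l := by
  induction l with
  | zero => exact FiberMeasurable.const _
  | succ l ih =>
    refine ih.bind (g := fun s' r => match s'.phase with
      | .query => { s with phase := .ended }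
      | _ => s'.next A P M (stream r (n + 1 + l))) fun s' => ?_
    split
    · exact FiberMeasurable.const _
    · exact (fiberMeasurable_next A P M s').comp (measurable_stream _)

theorem emulation_ended {n : ℕ} {s : Config} {a : Str} {r : Coins} {k l : ℕ} (hkl : k < l)
    (h : (emulation A P M n s a r k).phase = .query) :
    (emulation A P M n s a r l).phase = .ended := by
  induction l, hkl using Nat.le_induction with
  | base => simp [emulation, h]
  | succ l _ ih => simp [emulation, ih, Config.next]

/-- What the emulation returns in the configuration `s` at time `n`: a call of `M`, if this is
what happens next. -/
def emulationOutput (enc : ℕ × Config → Str) (n : ℕ) (s : Config) : Option (Str × Str) :=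
  match s.phase with
  -- The test only secures nonempty answers for arbitrary decoded states; messages of `P` are never
  -- empty.
  | .query => if s.message = [] then none else some (enc (n, s), s.message)
  | _ => none

variable {enc : ℕ × Config → Str} {dec : Str → ℕ × Config}

/-- The adversary against `M` that emulates `P` and the adversary `A`. -/
noncomputable def emulator (henc : ∀ s, enc s ≠ []) (dec : Str → ℕ × Config) :
    InteractiveAlgorithm where
  step s a r := firstSome fun l =>
    emulationOutput enc ((dec s).1 + 1 + l) (emulation A P M (dec s).1 (dec s).2 a r l)
  measurable_step s a := fiberMeasurable_firstSome fun l =>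
    (fiberMeasurable_emulation A P M _ _ a l).map _
  nonempty_output := by
    intro s a r s' b h
    obtain ⟨l, hl⟩ := firstSome_eq_some h
    unfold emulationOutput at hl
    split at hl
    · split_ifs at hl with hne
      simp only [Option.some.injEq, Prod.mk.injEq] at hl
      obtain ⟨rfl, rfl⟩ := hl
      exact ⟨henc _, hne⟩
    · simp at hl

theorem emulator_step (henc : ∀ s, enc s ≠ []) {s a : Str} {r : Coins} {l : ℕ}
    (hq : (emulation A P M (dec s).1 (dec s).2 a r l).phase = .query)
    (hne : (emulation A P M (dec s).1 (dec s).2 a r l).message ≠ []) :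
    (emulator A P M henc dec).step s a r =
      some (enc ((dec s).1 + 1 + l, emulation A P M (dec s).1 (dec s).2 a r l),
        (emulation A P M (dec s).1 (dec s).2 a r l).message) := by
  refine firstSome_eq_of_forall (k := l) (by simp [emulationOutput, hq, hne]) fun l' b hb => ?_
  have hq' : (emulation A P M (dec s).1 (dec s).2 a r l').phase = .query := by
    unfold emulationOutput at hb
    split at hb
    · assumption
    · simp at hb
  rcases lt_trichotomy l' l with h | rfl | h
  · rw [emulation_ended A P M h hq'] at hq
    cases hq
  · simpa [emulationOutput, hq, hne, eq_comm] using hb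
  · rw [emulation_ended A P M h hq] at hq'
    cases hq'

/-! #### Reconstruction from the view of the emulator -/

/-- The coins at an entry of a view. -/
def entryCoins : ViewEntry → Coins
  | Sum.inl r => r
  | Sum.inr _ => fun _ => false

theorem measurable_entryCoins : Measurable entryCoins := by
  have : entryCoins = Sum.elim id fun _ => fun _ => false := by
    funext e
    cases e <;> rfl
  rw [this]
  exact measurable_id.sumElim measurable_const

/-- One step of the reconstruction from the view `v` of the emulator. -/
def Config.replayStep (v : View) (n : ℕ) (s : Config) : Config :=
  match s.phase, s.mechanism with
  | .query, some t =>
    if s.message = haltMsg then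
      { s with phase := .answer, mechanism := none, message := haltMsg, calls := s.calls + 1 }
    -- The answer to call number `s.calls`, counted from `0`, is the message with that index; a
    -- missing message means that `M` did not terminate.
    else (viewMessages v s.calls).elim { s with phase := .ended, calls := s.calls + 1 } fun a =>
      { s with
        phase := .answer, mechanism := if a = haltMsg then none else some t, message := a,
        calls := s.calls + 1 }
  | _, _ => s.next A P M (stream (entryCoins (v (2 * s.emulationRound))) n)

/-- The configurations, up to the states of `M`, reconstructed from the view of the emulator. -/
def replay (v : View) : ℕ → Config
  | 0 => Config.init []
  | n + 1 => (replay v n).replayStep A P M v n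

theorem measurable_replay : Measurable (replay A P M) := by
  refine measurable_pi_lambda _ fun n => FiberMeasurable.measurable ?_
  induction n with
  | zero => exact FiberMeasurable.const _
  | succ n ih =>
    refine ih.bind (g := fun s v => s.replayStep A P M v n) fun s => ?_
    unfold Config.replayStep
    split
    · split_ifs
      · exact FiberMeasurable.const _
      · exact (Measurable.fiberMeasurable (g := fun v => viewMessages v s.calls)
          ((measurable_pi_apply _).comp measurable_viewMessages)).map fun o => o.elim _ _
    · exact (fiberMeasurable_next A P M s).comp
        ((measurable_stream n).comp (measurable_entryCoins.comp (measurable_pi_apply _)))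

/-! ### The chain along the interaction of the emulator with `M` -/

variable (x : Str) (ω : ℕ → Coins)

/-- The configurations during the interaction of the emulator with `M`. -/
def innerChain : ℕ → Config :=
  chain (Config.next A P M) innerAddr (Config.init x) (innerCoins ω)

/-- The configuration `s` occurs at time `n` in the interaction of the emulator with `M`, if that
interaction is not over. -/
def InnerReached (henc : ∀ s, enc s ≠ []) (dec : Str → ℕ × Config) (n : ℕ) (s : Config) : Prop :=
  ∀ t, s.mechanism = some t →
    (s.phase = .query → ∃ sB, interaction (emulator A P M henc dec) M x ω (2 * s.calls) =
        some (t, sB, s.message) ∧ dec sB = (n, s.forget)) ∧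
    -- Between calls the emulator is inside its move of round `2q + 2`, `l` steps after receiving
    -- `a`; its stored state `sB` is still that of the last call.
    (s.phase = .answer ∨ s.phase = .deliver → ∃ q sB a l, s.calls = q + 1 ∧
      interaction (emulator A P M henc dec) M x ω (2 * q + 1) = some (t, sB, a) ∧ a ≠ haltMsg ∧
      n = (dec sB).1 + 1 + l ∧
      emulation A P M (dec sB).1 (dec sB).2 a (ω (2 * q + 2)) l = s.forget)

variable {A P M x ω}

theorem innerReached_query {henc : ∀ s, enc s ≠ []} {n : ℕ} {s : Config}
    (hs : InnerReached A P M x ω henc dec n s) (hq : s.phase = .query) {t : Str}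
    (ht : s.mechanism = some t) :
    InnerReached A P M x ω henc dec (n + 1)
        (s.next A P M (innerCoins ω (innerAddr n s))) ∧
      (s.next A P M (innerCoins ω (innerAddr n s))).forget =
        s.forget.replayStep A P M (view (emulator A P M henc dec) M x ω) n := by
  obtain ⟨sB, hi, hsB⟩ := (hs t ht).1 hq
  obtain ⟨ph, u, sP, m, sA, j, k, q⟩ := s
  simp only at hq ht hi
  subst hq ht
  have hodd := interaction_odd (emulator A P M henc dec) M x ω q
  simp only [hi, Option.bind_some] at hodd
  simp only [Config.next, innerAddr, innerCoins, Config.forget, Config.replayStep,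
    viewMessages_view, messages, Option.map_some, callMechanism]
  by_cases hm : m = haltMsg
  · simp only [hm, if_true, Option.elim, Option.map_none, and_true]
    intro t' ht'
    cases ht'
  simp only [hm, if_false] at hodd ⊢
  rw [hodd]
  rcases hst : M.step t m (ω (2 * q + 1)) with - | o
  · simp only [Option.map_none, Option.elim, Option.map_some, and_true]
    intro t' ht'
    simp
  simp only [Option.map_some, Option.elim]
  by_cases ha : o.2 = haltMsg
  · simp only [ha, if_true, Option.map_none, and_true]
    intro t' ht'
    cases ht'
  simp only [ha, if_false, Option.map_some, and_true]
  intro t' ht'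
  obtain rfl := Option.some.inj ht'
  refine ⟨fun h => (nomatch h), fun _ => ⟨q, sB, o.2, 0, rfl, ?_, ha, by rw [hsB], ?_⟩⟩
  · rw [hodd, hst]
    rfl
  · rw [hsB]
    rfl

theorem entryCoins_view {B : InteractiveAlgorithm} {q : ℕ} {c : Str × Str × Str}
    (h : interaction B M x ω (2 * q + 1) = some c) (hc : c.2.2 ≠ haltMsg) :
    entryCoins (view B M x ω (2 * q + 2)) = ω (2 * q + 2) := by
  have h' : ¬ Odd (2 * q + 1 + 1) := by simp [parity_simps]
  simp [view, h', h, hc, entryCoins]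

/-- Chain, emulation and `replay` read the same stream of the coins of round `2q + 2`, which the
view shows because `a` is not `halt`. When the step leads to a query, the emulator's move ends there
and the invariant passes to the next call. -/
theorem innerReached_emulate {henc : ∀ s, enc s ≠ []} (hdec : ∀ s, dec (enc s) = s) {n : ℕ}
    {s : Config} (hs : InnerReached A P M x ω henc dec n s)
    (hp : s.phase = .answer ∨ s.phase = .deliver) {t : Str} (ht : s.mechanism = some t) :
    InnerReached A P M x ω henc dec (n + 1)
        (s.next A P M (innerCoins ω (innerAddr n s))) ∧
      (s.next A P M (innerCoins ω (innerAddr n s))).forget =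
        s.forget.replayStep A P M (view (emulator A P M henc dec) M x ω) n := by
  obtain ⟨q, sB, a, l, hq, hi, ha, hn, he⟩ := (hs t ht).2 hp
  have hnq : s.phase ≠ .query := by
    rintro h
    rw [h] at hp
    simp at hp
  have hround : s.emulationRound = q + 1 := by simp [Config.emulationRound, ht, hq]
  have hcoins : innerCoins ω (innerAddr n s) = stream (ω (2 * q + 2)) n := by
    have : innerAddr n s = .inr (q + 1, n) := by
      rw [← hround]
      rcases hp with hp | hp <;> simp [innerAddr, hp]
    rw [this]
    rfl
  have hfn := forget_next A P M (s := s) (fun h => absurd h hnq) (stream (ω (2 * q + 2)) n)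
  have hstep : emulation A P M (dec sB).1 (dec sB).2 a (ω (2 * q + 2)) (l + 1) =
      (s.next A P M (stream (ω (2 * q + 2)) n)).forget := by
    have hph : s.forget.phase = s.phase := rfl
    simp only [emulation, he, hfn, ← hn, hph]
  rw [hcoins]
  constructor
  · intro t' ht'
    rcases next_spec A P M hp (stream (ω (2 * q + 2)) n) with hst | ⟨h1, h2, h3, h4⟩
    · simp [hst]
    obtain rfl : t = t' := by
      rw [h1, ht] at ht'
      exact Option.some.inj ht'
    constructor
    · intro hquery
      have hB := emulator_step A P M (dec := dec) henc (s := sB) (a := a)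
        (r := ω (2 * q + 2)) (l := l + 1) (by rw [hstep]; exact hquery) (by rw [hstep]; exact h4)
      refine ⟨enc (n + 1, (s.next A P M (stream (ω (2 * q + 2)) n)).forget), ?_, hdec _⟩
      rw [h2, hq]
      change interaction _ M x ω (2 * q + 2) = _
      rw [interaction_even, hi, Option.bind_some, if_neg ha, hB, hstep, hn]
      rfl
    · exact fun _ => ⟨q, sB, a, l + 1, by rw [h2, hq], hi, ha, by omega, hstep⟩
  · rw [hfn]
    have hround' : s.forget.emulationRound = q + 1 := by
      simp [Config.emulationRound, Config.forget, ht, hq]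
    have hph : s.forget.phase = s.phase := rfl
    have hrp : s.forget.replayStep A P M (view (emulator A P M henc dec) M x ω) n =
        s.forget.next A P M (stream (entryCoins (view (emulator A P M henc dec) M x ω
          (2 * s.forget.emulationRound))) n) := by
      unfold Config.replayStep
      rw [hph]
      rcases hp with hp | hp <;> simp [hp]
    rw [hrp, hround']
    change _ = Config.next A P M _ (stream (entryCoins (view _ M x ω (2 * q + 2))) n)
    rw [entryCoins_view hi ha]

theorem innerReached_next {henc : ∀ s, enc s ≠ []} (hdec : ∀ s, dec (enc s) = s) {n : ℕ}
    {s : Config} (hs : InnerReached A P M x ω henc dec n s) :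
    InnerReached A P M x ω henc dec (n + 1)
        (s.next A P M (innerCoins ω (innerAddr n s))) ∧
      (s.next A P M (innerCoins ω (innerAddr n s))).forget =
        s.forget.replayStep A P M (view (emulator A P M henc dec) M x ω) n := by
  rcases hph : s.phase with - | - | - | -
  case ended =>
    have h1 : ∀ r, s.next A P M r = s := fun r => by rw [Config.next, hph]
    have h2 : ∀ r, s.forget.next A P M r = s.forget := fun r => by
      rw [Config.next, show s.forget.phase = _ from hph]
    have h3 : s.forget.phase = .ended := hph
    rw [h1]
    refine ⟨fun t _ => by simp [hph], ?_⟩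
    unfold Config.replayStep
    rw [h3]
    exact (h2 _).symm
  all_goals
    rcases ht : s.mechanism with - | t
  case query.some => exact innerReached_query hs hph ht
  case answer.some => exact innerReached_emulate hdec hs (Or.inl hph) ht
  case deliver.some => exact innerReached_emulate hdec hs (Or.inr hph) ht
  -- In the remaining cases the contact with `M` is over: the invariant is vacuous and the coins
  -- come from round `0`, which every view contains.
  all_goals
    have hcoins : innerCoins ω (innerAddr n s) = stream (ω 0) n := by
      simp [innerAddr, hph, ht, Config.emulationRound, innerCoins]
    have hph' : s.forget.phase = _ := hph
    have ht' : s.forget.mechanism = none := by simp [Config.forget, ht]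
    have hmech : ∀ r, (s.next A P M r).phase = .ended ∨ (s.next A P M r).mechanism = none := by
      intro r
      first
      | exact (next_spec A P M (Or.inl hph) r).imp id fun h => h.1.trans ht
      | exact (next_spec A P M (Or.inr hph) r).imp id fun h => h.1.trans ht
      | exact Or.inr (by simp [Config.next, hph, ht, callMechanism])
    constructor
    · intro t h
      rcases hmech (innerCoins ω (innerAddr n s)) with hst | hno
      · simp [hst]
      · rw [hno] at h
        cases h
    · rw [forget_next A P M (fun _ => ht), hcoins]
      simp [Config.replayStep, hph', ht', Config.emulationRound, view, entryCoins]

theorem innerReached_innerChain {henc : ∀ s, enc s ≠ []} (hdec : ∀ s, dec (enc s) = s)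
    (hnil : dec [] = (0, Config.init [])) (n : ℕ) :
    InnerReached A P M x ω henc dec n (innerChain A P M x ω n) ∧
      (innerChain A P M x ω n).forget =
        replay A P M (view (emulator A P M henc dec) M x ω) n := by
  induction n with
  | zero =>
    refine ⟨fun t ht => ⟨fun _ => ⟨[], ?_, hnil⟩, fun h => ?_⟩, rfl⟩
    · obtain rfl := Option.some.inj ht
      rfl
    · rcases h with h | h <;> cases h
  | succ n ih =>
    obtain ⟨h1, h2⟩ := innerReached_next hdec ih.1
    refine ⟨h1, ?_⟩
    change _ = Config.replayStep A P M _ n (replay A P M _ n)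
    rw [← ih.2]
    exact h2

theorem delivered_innerChain {henc : ∀ s, enc s ≠ []} (hdec : ∀ s, dec (enc s) = s)
    (hnil : dec [] = (0, Config.init [])) :
    delivered (innerChain A P M x ω) =
      delivered (replay A P M (view (emulator A P M henc dec) M x ω)) := by
  have h : replay A P M (view (emulator A P M henc dec) M x ω) =
      fun n => (innerChain A P M x ω n).forget :=
    funext fun n => (innerReached_innerChain hdec hnil n).2.symm
  rw [h]
  -- `delivered` reads only phase, round and message, which `forget` preserves.
  rfl

/-- The messages that a deterministic adversary receives from `P ∘ M` are distributed like a
function of the view of the emulator in its interaction with `M`. -/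
theorem messagesLaw_comp (hA : A.IsDeterministic) {henc : ∀ s, enc s ≠ []}
    (hdec : ∀ s, dec (enc s) = s) (hnil : dec [] = (0, Config.init [])) (x : Str) :
    messagesLaw A (P.comp M) x = (viewLaw (emulator A P M henc dec) M x).map
      (measurable_delivered.comp (measurable_replay A P M)).aemeasurable := by
  have hf := fiberMeasurable_next A P M
  have hcoins : Measurable outerCoins := by
    refine measurable_pi_lambda _ fun a => ?_
    rcases a with n | ⟨j, s⟩
    · exact (measurable_stream n).comp (measurable_pi_apply _)
    · exact (measurable_stream s).comp (measurable_pi_apply _)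
  have hcoins' : Measurable innerCoins := by
    refine measurable_pi_lambda _ fun a => ?_
    rcases a with q | ⟨i, n⟩
    · exact measurable_pi_apply _
    · exact (measurable_stream n).comp (measurable_pi_apply _)
  apply Subtype.ext
  change (Measure.infinitePi fun _ : ℕ => coinLaw).map (messages A (P.comp M) x) =
    ((Measure.infinitePi fun _ : ℕ => coinLaw).map (view (emulator A P M henc dec) M x)).map
      (delivered ∘ replay A P M)
  have h1 : messages A (P.comp M) x =
      delivered ∘ chain (Config.next A P M) outerAddr (Config.init x) ∘ outerCoins :=
    funext fun ω => messages_comp hA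
  have h2 : (delivered ∘ replay A P M) ∘ view (emulator A P M henc dec) M x =
      delivered ∘ chain (Config.next A P M) innerAddr (Config.init x) ∘ innerCoins :=
    funext fun ω => (delivered_innerChain hdec hnil).symm
  -- Both laws become images under `delivered` of the same chain, driven by independent coins at two
  -- fresh systems of addresses.
  rw [Measure.map_map (measurable_delivered.comp (measurable_replay A P M))
      (measurable_view _ _ _), h1, h2,
    ← Measure.map_map measurable_delivered ((measurable_chain hf _ _).comp hcoins),
    ← Measure.map_map measurable_delivered ((measurable_chain hf _ _).comp hcoins'),
    ← Measure.map_map (measurable_chain hf _ _) hcoins,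
    ← Measure.map_map (measurable_chain hf _ _) hcoins', map_outerCoins, map_innerCoins,
    map_chain_eq hf (freshAddresses_outer A P M) (freshAddresses_inner A P M)]

end Inner

/-! ### The theorem and the corollary -/

/-- Postprocessing by a person-in-the-middle mechanism preserves privacy. -/
theorem IsDP.comp {𝒟 : Type*} [PartialOrder 𝒟] {D : GeneralizedProbabilityDistance 𝒟}
    {X : Set Str} {adj : Str → Str → Prop} {d : 𝒟} {M : InteractiveAlgorithm}
    (hM : IsDP D X adj d M) (P : PIM) : IsDP D X adj d (P.comp M) := by
  intro A x hx x' hx' hadj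
  obtain ⟨enc, dec, henc, hdec, hnil⟩ := exists_coding ((0, Config.init []) : ℕ × Config)
  refine dist_viewLaw_le D d (P.comp M) x x' (fun A hA => ?_) A
  rw [messagesLaw_comp (henc := henc) hA hdec hnil x,
    messagesLaw_comp (henc := henc) hA hdec hnil x']
  exact (D.postprocessing _ (measurable_delivered.comp (measurable_replay A P M)) _ _).trans
    (hM _ x hx x' hx' hadj)

theorem mainTheorem5 {𝒟 : Type*} [PartialOrder 𝒟] (D : GeneralizedProbabilityDistance 𝒟)
    (X : Set Str) (adj : Str → Str → Prop) (d : 𝒟) :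
    (∀ (P : PIM) (M : InteractiveAlgorithm), IsDP D X adj d M → IsDP D X adj d (P.comp M)) ∧
    (∀ N : InteractiveAlgorithm,
      (∀ x ∈ X, ∀ x' ∈ X, adj x x' → ∀ A : InteractiveAlgorithm, A.IsDeterministic →
        ∃ (M : InteractiveAlgorithm) (P : PIM), IsDP D {x, x'} adj d M ∧
          viewLaw A N x = viewLaw A (P.comp M) x ∧
          viewLaw A N x' = viewLaw A (P.comp M) x') →
      IsDP D X adj d N) := by
  refine ⟨fun P M hM => hM.comp P, fun N hN A x hx x' hx' hadj => ?_⟩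
  refine dist_viewLaw_le D d N x x' (fun A hA => ?_) A
  -- `M` and `P` may depend on `A` and on the pair, since the bound is needed for one deterministic
  -- adversary and one pair at a time.
  obtain ⟨M, P, hM, h, h'⟩ := hN x hx x' hx' hadj A hA
  rw [← map_viewLaw, ← map_viewLaw, h, h']
  exact (D.postprocessing _ measurable_viewMessages _ _).trans
    (hM.comp P A x (by simp) x' (by simp) hadj)
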